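/- Let $q=p^r$ be a prime power, $\omega=e^{2\pi i/p}$, $\operatorname{tr}:\mathbb F_q\to\mathbb F_p$ the trace, $\mathcal H$ the $q$-dimensional Hilbert space with basis $\{|j\rangle\}_{j\in\mathbb F_q}$, and for $w=(a,b)\in\mathbb F_q^{2n}$ let $\mathbf W(w)=\bigotimes_{i=1}^n \mathsf X(a_i)\mathsf Z(b_i)$ on $\mathcal H^{\otimes n}$, where $\mathsf X(a)=\sum_j|j+a\rangle\langle j|$, $\mathsf Z(b)=\sum_j\omega^{\operatorname{tr}(bj)}|j\rangle\langle j|$. Equip $\mathbb F_q^{2n}$ with the symplectic form $((x,y),(x',y'))=\operatorname{tr}\sum_i x_iy'_i-\operatorname{tr}\sum_i x'_iy_i$; matrices are called column-orthogonal to each other (a matrix is self-column-orthogonal) when the $\mathbb F_q$-spans of their columns are orthogonal (the $\mathbb F_q$-span of its columns is orthogonal to itself) for this form. Let $0\le\ell\le n$, let $G^{(1)}\in\mathbb F_q^{2n\times(n-\ell)}$ be self-column-orthogonal, $G^{(2)}\in\mathbb F_q^{2n\times s}$ arbitrary, and $F\in\mathbb F_q^{2n\times 2\ell}$ column-orthogonal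 to $G^{(1)}$, such that the columns of $(G^{(1)},F)$ are linearly independent. Let $V:\mathcal H^{\otimes\ell}\to\mathcal H^{\otimes n}$ be an isometry whose range $\mathcal C$ is a joint eigenspace of the commuting unitaries $\mathbf W(G^{(1)}y)$, $y\in\mathbb F_q^{n-\ell}$. Let $(\mathfrak A,\mathfrak B)$ be an access structure on $[n]$: $\mathfrak A\subseteq 2^{[n]}$ is closed under supersets, $\mathfrak B\subseteq 2^{[n]}$ is closed under subsets, and $\mathfrak A\cap\mathfrak B=\emptyset$. For $A\subseteq[n]$ put $\bar A=A\cup(n+A)\subseteq[2n]$, $\bar{\mathfrak A}=\{\bar A: A\in\mathfrak A\}$, $\bar{\mathfrak B}=\{\bar B:B\in\mathfrak B\}$. * Linear QQSS protocol: $\Gamma(\rho)=q^{-s}\sum_{u\in\mathbb F_q^{s}}\mathbf W(G^{(2)}u)V\rho V^\dagger\mathbf W(G^{(2)}u)^\dagger$ for states $\rho$ on $\mathcal H^{\otimes\ell}$; the $i$-th tensor factor is the share of player $i$. It is $(\mathfrak A,\mathfrak B)$-secure if for each $A\in\mathfrak A$ there is a TP-CP map $D$ with $D(\operatorname{Tr}_{A^c}\Gamma(\rho))=\rho$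 for all states $\rho$ (one says that $D$ decodes for $A$), and for each $B\in\mathfrak B$ the state $\operatorname{Tr}_{B^c}\Gamma(\rho)$ does not depend on $\rho$. * Linear EASS protocol: with $|\Phi\rangle=q^{-\ell/2}\sum_{x\in\mathbb F_q^\ell}V|x\rangle\otimes|x\rangle$, where the second factor $\mathcal D_E\cong\mathcal H^{\otimes\ell}$ (a copy of $\mathcal C$ with basis $V|x\rangle$) belongs to the end-user, the message $m\in\mathbb F_q^{2\ell}$ gives the state $\tau_m=q^{-s}\sum_{u}\mathbf W(Fm+G^{(2)}u)|\Phi\rangle\langle\Phi|\mathbf W(Fm+G^{(2)}u)^\dagger$, with $\mathbf W$ acting on the first factor. It is $(\mathfrak A,\mathfrak B)$-secure if for each $A\in\mathfrak A$ there is a POVM $\Pi=\{\Pi_m\}_{m\in\mathbb F_q^{2\ell}}$ on $\mathcal H^{\otimes A}\otimes\mathcal D_E$ with $\operatorname{Tr}(\operatorname{Tr}_{A^c}\tau_m)\Pi_m=1$ for all $m$ (one says that $\Pi$ decodes for $A$), and for each $B\in\mathfrak B$ the state $\operatorname{Tr}_{B^c}\tau_m$ does not depend on $m$. * Linear CSS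 protocol with $(G,F)$, $G=(G^{(1)},G^{(2)})$: the $2n$ shares are the coordinates of $Z=Fm+GU$ with $U$ uniform. It is $(\bar{\mathfrak A},\bar{\mathfrak B})$-secure if for each $A\in\bar{\mathfrak A}$ the message $m$ can be recovered with probability one from $(Z_i)_{i\in A}$, and for each $B\in\bar{\mathfrak B}$ the distribution of $(Z_i)_{i\in B}$ does not depend on $m$. * $(G,F)$ is an $(\bar{\mathfrak A},\bar{\mathfrak B})$-MMSP if, with $P_A$ denoting restriction to the rows in $A$, for each $A\in\bar{\mathfrak A}$ the columns of $P_AF$ are linearly independent modulo $\operatorname{Im}P_AG$, and for each $B\in\bar{\mathfrak B}$ the columns of $P_BF$ lie in the span of the columns of $P_BG$. Then the following conditions are equivalent: (J1) the linear QQSS protocol is $(\mathfrak A,\mathfrak B)$-secure; (J2) the linear CSS protocol with $((G^{(1)},G^{(2)}),F)$ is $(\bar{\mathfrak A},\bar{\mathfrak B})$-secure; (J3) $((G^{(1)},G^{(2)}),F)$ is an $(\bar{\mathfrak A},\bar{\mathfrak B})$-MMSP; (J4) the linear EASS protocol is $(\mathfrak A,\mathfrak B)$-secure. Moreover, for each $A\in\mathfrak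 A$ and each POVM $\Pi=\{\Pi_m\}$ that decodes for $A$ in the linear EASS protocol (such a $\Pi$ exists for every $A\in\mathfrak A$ when the conditions hold), the map $$\overline\Gamma[\Pi](\rho)=\sum_{m\in\mathbb F_q^{2\ell}}U_m\operatorname{Tr}_{BR}\big((\rho_B\otimes|\phi\rangle\langle\phi|_{RM})(\Pi_m\otimes I_M)\big)U_m^\dagger,\qquad U_m=V^\dagger\mathbf W(Fm)V,$$ is a TP-CP map that decodes for $A$ in the linear QQSS protocol. Here $B$ is the system $\mathcal H^{\otimes A}$ of the shares of $A$, $R$ and $M$ are copies of $\mathcal H^{\otimes\ell}$ with $R=\mathcal D_E$, $|\phi\rangle=q^{-\ell/2}\sum_{x\in\mathbb F_q^\ell}|x\rangle|x\rangle$ on $R\otimes M$, and $\Pi_m$ acts on $B\otimes R$. -/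

import Mathlib

open scoped Matrix Kronecker ComplexOrder

noncomputable section

namespace QSS

/-! ### Symplectic geometry over a finite field

`K` is the finite field `𝔽_q` of characteristic `p`. A vector of `K^{2n}` is a function
`w : ι ⊕ ι → K` with `ι = Fin n`; `w (Sum.inl i)` and `w (Sum.inr i)` are the coordinates
numbered `i` and `n + i`. -/

section Symplectic

variable (p : ℕ) [Fact p.Prime] {K : Type*} [Field K] [Fintype K] [DecidableEq K]
  [Algebra (ZMod p) K] {ι κ κ' : Type*} [Fintype ι] [Fintype κ] [Fintype κ']

/-- The `𝔽_p`-valued symplectic inner product `((x, y), (x', y')) = ⟨x, y'⟩ - ⟨x', y⟩`, with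
`⟨x, y⟩ = tr ∑ i, x i * y i`. -/
def symp (v w : ι ⊕ ι → K) : ZMod p :=
  Algebra.trace (ZMod p) K (∑ i, v (Sum.inl i) * w (Sum.inr i)) -
    Algebra.trace (ZMod p) K (∑ i, w (Sum.inl i) * v (Sum.inr i))

/-- `F` is column-orthogonal to `G`: the `𝔽_q`-spans of the columns of `F` and of `G` are
orthogonal. -/
def ColumnOrthogonal (F : Matrix (ι ⊕ ι) κ K) (G : Matrix (ι ⊕ ι) κ' K) : Prop :=
  ∀ (x : κ → K) (y : κ' → K), symp p (F *ᵥ x) (G *ᵥ y) = 0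

/-- `G` is self-column-orthogonal: the `𝔽_q`-span of its columns is self-orthogonal. -/
def SelfColumnOrthogonal (G : Matrix (ι ⊕ ι) κ K) : Prop :=
  ColumnOrthogonal p G G

end Symplectic

/-! ### Access structures -/

/-- An access structure: a monotone increasing and a monotone decreasing collection without a
common element. -/
structure IsAccessStructure {ι : Type*} (𝔄 𝔅 : Set (Finset ι)) : Prop where
  increasing : IsUpperSet 𝔄
  decreasing : IsLowerSet 𝔅
  disjoint : Disjoint 𝔄 𝔅

/-- The symplectification of a collection of subsets: `A ⊆ [n]` is replaced by
`{i, n + i | i ∈ A} ⊆ [2n]`. -/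
def symplectification {ι : Type*} (𝔄 : Set (Finset ι)) : Set (Finset (ι ⊕ ι)) :=
  (fun A => A.disjSum A) '' 𝔄

/-! ### Classical linear secret sharing and multi-target monotone span programs -/

section Classical

variable {K : Type*} [Field K] [Fintype K] {ι κ μ : Type*} [Fintype κ] [DecidableEq κ] [Fintype μ]

/-- The joint distribution of the shares `Z = F m + G U`, with `U` uniform. -/
def cssShares (G : Matrix ι κ K) (F : Matrix ι μ K) (m : μ → K) : PMF (ι → K) :=
  (PMF.uniformOfFintype (κ → K)).map fun u => F *ᵥ m + G *ᵥ u

/-- The joint distribution of the shares of the players in `A`. -/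
def cssMarginal (G : Matrix ι κ K) (F : Matrix ι μ K) (A : Finset ι) (m : μ → K) :
    PMF (A → K) :=
  (cssShares G F m).map (fun z i => z i)

/-- Security of the linear CSS protocol with `(G, F)`: every `A ∈ 𝔄` has a (possibly randomized)
decoder that outputs the message with probability one, and the joint distribution of the shares
of every `B ∈ 𝔅` does not depend on the message. -/
def CSSSecure (G : Matrix ι κ K) (F : Matrix ι μ K) (𝔄 𝔅 : Set (Finset ι)) : Prop :=
  (∀ A ∈ 𝔄, ∃ dec : (A → K) → PMF (μ → K),
    ∀ m, (cssMarginal G F A m).bind dec = PMF.pure m) ∧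
  ∀ B ∈ 𝔅, ∀ m m', cssMarginal G F B m = cssMarginal G F B m'

/-- `P_A G`: the rows of `G` with index in `A`. -/
def rowsOf (A : Finset ι) (G : Matrix ι κ K) : Matrix A κ K :=
  G.submatrix (fun i => (i : ι)) id

/-- Acceptance of `A`: the columns of `P_A F` are linearly independent modulo `Im P_A G`. -/
def Accepts (G : Matrix ι κ K) (F : Matrix ι μ K) (A : Finset ι) : Prop :=
  LinearIndependent K fun j : μ =>
    (LinearMap.range (rowsOf A G).mulVecLin).mkQ ((rowsOf A F).col j)

/-- Rejection of `B`: each column of `P_B F` is in the linear span of the columns of `P_B G`. -/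
def Rejects (G : Matrix ι κ K) (F : Matrix ι μ K) (B : Finset ι) : Prop :=
  ∀ j : μ, (rowsOf B F).col j ∈ Submodule.span K (Set.range (rowsOf B G).col)

/-- `(G, F)` is an `(𝔄, 𝔅)`-MMSP. -/
def IsMMSP (G : Matrix ι κ K) (F : Matrix ι μ K) (𝔄 𝔅 : Set (Finset ι)) : Prop :=
  (∀ A ∈ 𝔄, Accepts G F A) ∧ ∀ B ∈ 𝔅, Rejects G F B

end Classical

/-! ### Quantum systems

A finite-dimensional system with an orthonormal basis indexed by `S` has the matrices
`Matrix S S ℂ` as operators; `S × T` indexes the tensor product. The space `𝓗^{⊗ι}`, where `𝓗`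
is the `q`-dimensional space with basis `|j⟩`, `j ∈ 𝔽_q`, is indexed by `ι → K`. -/

section Quantum

variable {S T X : Type*} [Fintype S] [Fintype T] [Fintype X] [DecidableEq S]

/-- Density matrices. -/
def IsState (ρ : Matrix S S ℂ) : Prop :=
  ρ.PosSemidef ∧ ρ.trace = 1

/-- Positive-operator valued measures with outcomes in `X`. -/
def IsPOVM (P : X → Matrix S S ℂ) : Prop :=
  (∀ x, (P x).PosSemidef) ∧ ∑ x, P x = 1

/-- The map `κ ⊗ id` on the operators on `S ⊗ ℂ^d`. -/
def ampliation (κ : Matrix S S ℂ →ₗ[ℂ] Matrix T T ℂ) (d : ℕ)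
    (ρ : Matrix (S × Fin d) (S × Fin d) ℂ) : Matrix (T × Fin d) (T × Fin d) ℂ :=
  Matrix.of fun t t' => κ (Matrix.of fun s s' => ρ (s, t.2) (s', t'.2)) t.1 t'.1

/-- Trace-preserving completely positive maps. -/
def IsTPCP (κ : Matrix S S ℂ → Matrix T T ℂ) : Prop :=
  ∃ L : Matrix S S ℂ →ₗ[ℂ] Matrix T T ℂ, (∀ ρ, L ρ = κ ρ) ∧
    (∀ ρ, IsState ρ → (κ ρ).trace = 1) ∧
    ∀ (d : ℕ) (ρ : Matrix (S × Fin d) (S × Fin d) ℂ), IsState ρ → (ampliation L d ρ).PosSemidef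

/-- The partial trace over the first factor. -/
def traceFst (M : Matrix (S × T) (S × T) ℂ) : Matrix T T ℂ :=
  Matrix.of fun t t' => ∑ s, M (s, t) (s, t')

end Quantum

section Shares

variable {K : Type*} [Fintype K] {ι E M : Type*} [DecidableEq ι] [Fintype ι]

/-- The basis label of `𝓗^{⊗ι}` with restriction `x` to `A` and `z` to the complement of `A`. -/
def glue (A : Finset ι) (x : A → K) (z : {i // i ∉ A} → K) : ι → K :=
  fun i => if h : i ∈ A then x ⟨i, h⟩ else z ⟨i, h⟩

/-- The partial trace over the shares outside `A`. -/
def reduceTo (A : Finset ι) (ρ : Matrix (ι → K) (ι → K) ℂ) : Matrix (A → K) (A → K) ℂ :=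
  Matrix.of fun x x' => ∑ z : {i // i ∉ A} → K, ρ (glue A x z) (glue A x' z)

/-- The partial trace over the shares outside `A`, in presence of an additional system `E`, which
is kept. -/
def reduceToWith (A : Finset ι) (ρ : Matrix ((ι → K) × E) ((ι → K) × E) ℂ) :
    Matrix ((A → K) × E) ((A → K) × E) ℂ :=
  Matrix.of fun x x' =>
    ∑ z : {i // i ∉ A} → K, ρ (glue A x.1 z, x.2) (glue A x'.1 z, x'.2)

variable [DecidableEq K] [Fintype E] [DecidableEq E] [Fintype M] [DecidableEq M]

/-- For the QQSS protocol with encoder `Γ`, the TP-CP map `D` recovers the message from the shares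
of the players in `A`. -/
def QQSSDecodes (Γ : Matrix M M ℂ → Matrix (ι → K) (ι → K) ℂ) (A : Finset ι)
    (D : Matrix (A → K) (A → K) ℂ → Matrix M M ℂ) : Prop :=
  IsTPCP D ∧ ∀ ρ, IsState ρ → D (reduceTo A (Γ ρ)) = ρ

/-- `(𝔄, 𝔅)`-security of the QQSS protocol with encoder `Γ` and message system `M`. -/
def QQSSSecure (Γ : Matrix M M ℂ → Matrix (ι → K) (ι → K) ℂ) (𝔄 𝔅 : Set (Finset ι)) : Prop :=
  (∀ A ∈ 𝔄, ∃ D, QQSSDecodes Γ A D) ∧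
  ∀ B ∈ 𝔅, ∀ ρ σ, IsState ρ → IsState σ → reduceTo B (Γ ρ) = reduceTo B (Γ σ)

/-- For the EASS protocol in which `τ m` is the joint state of the shares and of the end-user's
system `E` for the message `m`, the POVM `P` recovers the message from the shares of the players
in `A` and `E`. -/
def EASSDecodes (τ : M → Matrix ((ι → K) × E) ((ι → K) × E) ℂ) (A : Finset ι)
    (P : M → Matrix ((A → K) × E) ((A → K) × E) ℂ) : Prop :=
  IsPOVM P ∧ ∀ m, (reduceToWith A (τ m) * P m).trace = 1

/-- `(𝔄, 𝔅)`-security of the EASS protocol with states `τ m`. -/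
def EASSSecure (τ : M → Matrix ((ι → K) × E) ((ι → K) × E) ℂ) (𝔄 𝔅 : Set (Finset ι)) : Prop :=
  (∀ A ∈ 𝔄, ∃ P, EASSDecodes τ A P) ∧
  ∀ B ∈ 𝔅, ∀ m m', reduceToWith B (τ m) = reduceToWith B (τ m')

end Shares

/-! ### Weyl operators and stabilizer encodings -/

section Weyl

variable (p : ℕ) [Fact p.Prime] {K : Type*} [Field K] [Fintype K] [DecidableEq K]
  [Algebra (ZMod p) K] {ι κ : Type*} [Fintype ι] [DecidableEq ι] [Fintype κ]

/-- `X(a) = ∑ j, |j + a⟩⟨j|`. -/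
def shiftX (a : K) : Matrix K K ℂ :=
  Matrix.of fun i j => if i = j + a then 1 else 0

/-- `Z(b) = ∑ j, ω^{tr (b j)} |j⟩⟨j|` with `ω = exp (2πi/p)`. -/
def phaseZ (b : K) : Matrix K K ℂ :=
  Matrix.diagonal fun j => ZMod.stdAddChar (Algebra.trace (ZMod p) K (b * j))

/-- `W(a, b) = X(a₁)Z(b₁) ⊗ ⋯ ⊗ X(aₙ)Z(bₙ)`. -/
def weyl (w : ι ⊕ ι → K) : Matrix (ι → K) (ι → K) ℂ :=
  Matrix.of fun x y => ∏ i, (shiftX (w (Sum.inl i)) * phaseZ p (w (Sum.inr i))) (x i) (y i)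

/-- `V` is an isometry from `𝓗^{⊗ℓ}` onto a joint eigenspace of the Weyl operators `W(G y)`. The
columns of `V` are then an orthonormal basis `|x, 0⟩`, `x ∈ 𝔽_q^ℓ`, of that space. -/
def IsStabilizerEncoding {ℓ : ℕ} (G : Matrix (ι ⊕ ι) κ K) (V : Matrix (ι → K) (Fin ℓ → K) ℂ) :
    Prop :=
  Vᴴ * V = 1 ∧ ∃ χ : (κ → K) → ℂ, ∀ ψ : (ι → K) → ℂ,
    ψ ∈ LinearMap.range V.mulVecLin ↔ ∀ y, weyl p (G *ᵥ y) *ᵥ ψ = χ y • ψ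

end Weyl

/-! ### The linear QQSS and EASS protocols -/

section Protocols

variable (p : ℕ) [Fact p.Prime] {K : Type*} [Field K] [Fintype K] [DecidableEq K]
  [Algebra (ZMod p) K] {ι κ μ : Type*} [Fintype ι] [DecidableEq ι] [Fintype κ] [DecidableEq κ]
  [Fintype μ] [DecidableEq μ] {ℓ : ℕ}

/-- Share generation of the linear QQSS protocol: the message is encoded by `V`, then `W(G₂ u)` is
applied with `u` uniform. -/
def qqssEncoder (V : Matrix (ι → K) (Fin ℓ → K) ℂ) (G₂ : Matrix (ι ⊕ ι) κ K)
    (ρ : Matrix (Fin ℓ → K) (Fin ℓ → K) ℂ) : Matrix (ι → K) (ι → K) ℂ :=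
  ∑ u : κ → K, ((Fintype.card (κ → K) : ℂ)⁻¹) •
    (weyl p (G₂ *ᵥ u) * (V * ρ * Vᴴ) * (weyl p (G₂ *ᵥ u))ᴴ)

/-- The preshared state vector `∑ x, q^{-ℓ/2} |x, 0⟩|x, 0⟩`. The end-user's system is the code
space, with labels `x ∈ 𝔽_q^ℓ` for its basis `|x, 0⟩`. -/
def codeEntangled (V : Matrix (ι → K) (Fin ℓ → K) ℂ) : (ι → K) × (Fin ℓ → K) → ℂ :=
  fun de => ((Real.sqrt (Fintype.card (Fin ℓ → K)) : ℝ) : ℂ)⁻¹ * V de.1 de.2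

/-- The joint state of the shares and of the end-user's system in the linear EASS protocol for the
message `m`: `W(F m + G₂ u)`, with `u` uniform, is applied to the dealer's half of the preshared
state. -/
def eassState (V : Matrix (ι → K) (Fin ℓ → K) ℂ) (G₂ : Matrix (ι ⊕ ι) κ K)
    (F : Matrix (ι ⊕ ι) μ K) (m : μ → K) :
    Matrix ((ι → K) × (Fin ℓ → K)) ((ι → K) × (Fin ℓ → K)) ℂ :=
  ∑ u : κ → K, ((Fintype.card (κ → K) : ℂ)⁻¹) •
    ((weyl p (F *ᵥ m + G₂ *ᵥ u) ⊗ₖ (1 : Matrix (Fin ℓ → K) (Fin ℓ → K) ℂ)) *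
      Matrix.vecMulVec (codeEntangled V) (star (codeEntangled V)) *
      (weyl p (F *ᵥ m + G₂ *ᵥ u) ⊗ₖ (1 : Matrix (Fin ℓ → K) (Fin ℓ → K) ℂ))ᴴ)

/-- The maximally entangled state vector `q^{-ℓ/2} ∑ x, |x⟩|x⟩` on `𝓗^{⊗ℓ} ⊗ 𝓗^{⊗ℓ}`. -/
def maxEntangled : (Fin ℓ → K) × (Fin ℓ → K) → ℂ :=
  fun ra => if ra.1 = ra.2 then ((Real.sqrt (Fintype.card (Fin ℓ → K)) : ℝ) : ℂ)⁻¹ else 0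

/-- The action of `W(w)` on the code space, as an operator on `𝓗^{⊗ℓ}`. -/
def logicalWeyl (V : Matrix (ι → K) (Fin ℓ → K) ℂ) (w : ι ⊕ ι → K) :
    Matrix (Fin ℓ → K) (Fin ℓ → K) ℂ :=
  Vᴴ * weyl p w * V

/-- The map `Γ̄[Π] ρ = ∑ m, U_m (Tr_{B,R} ((ρ_B ⊗ |φ⟩⟨φ|_{RA}) ((Π_m)_{BR} ⊗ I_A))) U_m†`, with
`|φ⟩` maximally entangled between `R` and `A` (both `𝓗^{⊗ℓ}`), and `U_m` the action of `W(F m)` on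
the code space. -/
def teleportDecoder {B : Type*} [Fintype B] [DecidableEq B]
    (V : Matrix (ι → K) (Fin ℓ → K) ℂ) (F : Matrix (ι ⊕ ι) μ K)
    (P : (μ → K) → Matrix (B × (Fin ℓ → K)) (B × (Fin ℓ → K)) ℂ)
    (ρ : Matrix B B ℂ) : Matrix (Fin ℓ → K) (Fin ℓ → K) ℂ :=
  ∑ m : μ → K, logicalWeyl p V (F *ᵥ m) *
    traceFst
      (((ρ ⊗ₖ Matrix.vecMulVec (maxEntangled (K := K) (ℓ := ℓ)) (star maxEntangled)).submatrix
          (Equiv.prodAssoc B (Fin ℓ → K) (Fin ℓ → K))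
          (Equiv.prodAssoc B (Fin ℓ → K) (Fin ℓ → K))) *
        (P m ⊗ₖ (1 : Matrix (Fin ℓ → K) (Fin ℓ → K) ℂ))) *
    (logicalWeyl p V (F *ᵥ m))ᴴ

end Protocols

end QSS

end

/-! Write `G = (G₁, G₂)`. All four conditions reduce to linear algebra on the coordinates of a set
`A` of players: acceptance says that `F m` agrees on `A` with a vector of `Im G` only for `m = 0`,
rejection says that every `F m` agrees on the set with some vector of `Im G`. For the classical
protocol this is immediate, because a translation of the uniform `U` absorbs any vector of `Im G`.

On the quantum side, a Weyl operator orthogonal to `G₁` preserves the code and acts on it as a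
logical unitary. A column of `G₁` acts by a phase, which cancels under conjugation, and a column of
`G₂` is absorbed by the randomness; so only the class of `F m` modulo `Im G` on `A` influences the
reduced state (`IsStabilizerEncoding.reduceTo_qqssEncoder_conj`). Conversely, if `F m` and `F m'`
differ on `A` by a vector outside `Im G`, a Weyl operator on `A`, paired with a unitary of the
end-user, separates the two EASS states into distinct eigenspaces
(`IsStabilizerEncoding.weyl_conj_orthogonal`). Thus acceptance gives perfect discrimination, and
equality of reduced states forces rejection.

The passage between the protocols rests on the `q^{2ℓ}` logical unitaries `U_m`, which are pairwise
trace-orthogonal and hence an orthogonal basis of the operators on the message space. Their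
entangled vectors form an orthonormal basis, so a perfect EASS measurement, pulled back through the
encoder, must be the corresponding Bell measurement, and teleportation with it decodes quantum
messages (`sum_conj_teleportResidue_krausMap`). Averaging over the `U_m` depolarizes completely, so
secrecy for the `m` gives secrecy for all states. -/

noncomputable section

namespace QSS

/-! ### Classical linear secret sharing and span programs -/

section Classical

variable {K : Type*} [Field K] {ι κ μ : Type*} [Fintype κ] [Fintype μ]

theorem accepts_iff (G : Matrix ι κ K) (F : Matrix ι μ K) (A : Finset ι) :
    Accepts G F A ↔ ∀ m u, (∀ i ∈ A, (F *ᵥ m) i = (G *ᵥ u) i) → m = 0 := by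
  unfold Accepts
  rw [Fintype.linearIndependent_iff]
  have key : ∀ m : μ → K,
      ∑ j, m j • (LinearMap.range (rowsOf A G).mulVecLin).mkQ ((rowsOf A F).col j) = 0 ↔
        ∃ u, ∀ i ∈ A, (F *ᵥ m) i = (G *ᵥ u) i := by
    intro m
    simp_rw [← map_smul]
    rw [← map_sum, Submodule.mkQ_apply, Submodule.Quotient.mk_eq_zero, LinearMap.mem_range]
    refine exists_congr fun u => ?_
    rw [funext_iff, Subtype.forall]
    refine forall₂_congr fun i hi => ?_
    have h1 : ((rowsOf A G).mulVecLin u) ⟨i, hi⟩ = (G *ᵥ u) i := rfl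
    have h2 : (∑ j, m j • (rowsOf A F).col j) ⟨i, hi⟩ = (F *ᵥ m) i := by
      simp [Matrix.mulVec, dotProduct, rowsOf, Finset.sum_apply, mul_comm]
    rw [h1, h2, eq_comm]
  simp_rw [key]
  constructor
  · intro h m u hu
    exact funext (h m ⟨u, hu⟩)
  · rintro h m ⟨u, hu⟩ i
    rw [h m u hu]; rfl

theorem rejects_iff (G : Matrix ι κ K) (F : Matrix ι μ K) (B : Finset ι) :
    Rejects G F B ↔ ∀ m, ∃ u, ∀ i ∈ B, (F *ᵥ m) i = (G *ᵥ u) i := by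
  classical
  unfold Rejects
  rw [← Matrix.range_mulVecLin]
  have key : ∀ m : μ → K, (rowsOf B F) *ᵥ m ∈ LinearMap.range (rowsOf B G).mulVecLin ↔
        ∃ u, ∀ i ∈ B, (F *ᵥ m) i = (G *ᵥ u) i := by
    intro m
    rw [LinearMap.mem_range]
    refine exists_congr fun u => ?_
    rw [funext_iff, Subtype.forall]
    exact forall₂_congr fun i hi => eq_comm
  simp_rw [← key]
  constructor
  · intro h m
    simp_rw [Matrix.mulVec_eq_sum, op_smul_eq_smul]
    exact Submodule.sum_mem _ fun j _ => Submodule.smul_mem _ _ (h j)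
  · intro h j
    have := h (Pi.single j 1)
    rwa [Matrix.mulVec_single_one] at this

variable [Fintype K] [DecidableEq κ]

theorem cssMarginal_eq_map (G : Matrix ι κ K) (F : Matrix ι μ K) (A : Finset ι) (m : μ → K) :
    cssMarginal G F A m =
      (PMF.uniformOfFintype (κ → K)).map fun u (i : A) => (F *ᵥ m + G *ᵥ u) i := by
  rw [cssMarginal, cssShares, PMF.map_comp]; rfl

theorem map_equiv_uniformOfFintype {α : Type*} [Fintype α] [Nonempty α] (e : α ≃ α) :
    (PMF.uniformOfFintype α).map e = PMF.uniformOfFintype α := by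
  ext a
  rw [PMF.map_apply, tsum_eq_single (e.symm a)]
  · simp
  · intro b hb
    rw [if_neg]
    rintro rfl
    simp at hb

/-- Translation of the uniform `U` by `u` turns one share vector into the other on `A`. -/
theorem cssMarginal_congr (G : Matrix ι κ K) (F : Matrix ι μ K) (A : Finset ι) {m m' : μ → K}
    {u : κ → K} (h : ∀ i ∈ A, (F *ᵥ (m - m')) i = (G *ᵥ u) i) :
    cssMarginal G F A m = cssMarginal G F A m' := by
  rw [cssMarginal_eq_map, cssMarginal_eq_map]
  conv_rhs => rw [← map_equiv_uniformOfFintype (Equiv.addRight u), PMF.map_comp]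
  congr 1
  ext v i
  have := h i i.2
  rw [Matrix.mulVec_sub] at this
  simp only [Pi.sub_apply] at this
  simp only [Function.comp, Equiv.coe_addRight, Matrix.mulVec_add, Pi.add_apply, ← this]
  ring

theorem cssSecure_iff_isMMSP (G : Matrix ι κ K) (F : Matrix ι μ K) (𝔄 𝔅 : Set (Finset ι)) :
    CSSSecure G F 𝔄 𝔅 ↔ IsMMSP G F 𝔄 𝔅 := by
  classical
  unfold CSSSecure IsMMSP
  refine and_congr (forall₂_congr fun A _ => ?_) (forall₂_congr fun B _ => ?_)
  · rw [accepts_iff]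
    constructor
    -- The messages `m` and `0` have the same marginal on `A`, so one decoder must output both with
    -- certainty.
    · rintro ⟨dec, hdec⟩ m u hu
      have h1 := hdec m
      rw [cssMarginal_congr G F A (m' := 0) (u := u) (by simpa using hu), hdec 0] at h1
      have h2 : m ∈ (PMF.pure (0 : μ → K)).support := by rw [h1]; simp
      simpa using h2
    · intro h
      -- The decoder outputs any message consistent with the observed shares; the default `0` is
      -- never reached on actual shares.
      refine ⟨fun z => PMF.pure (if hz : ∃ m, ∃ u, ∀ i : A, (F *ᵥ m + G *ᵥ u) i = z i then
        hz.choose else 0), fun m => ?_⟩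
      rw [cssMarginal_eq_map, PMF.bind_map]
      convert PMF.bind_const _ _ using 2
      ext1 u
      have hz : ∃ m', ∃ u', ∀ i : A, (F *ᵥ m' + G *ᵥ u') i = (F *ᵥ m + G *ᵥ u) i :=
        ⟨m, u, fun _ => rfl⟩
      simp only [Function.comp]
      rw [dif_pos hz]
      obtain ⟨u', hu'⟩ := hz.choose_spec
      congr 1
      rw [← sub_eq_zero]
      refine h _ (u - u') fun i hi => ?_
      have := hu' ⟨i, hi⟩
      simp only [Pi.add_apply] at this
      simp only [Matrix.mulVec_sub, Pi.sub_apply]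
      linear_combination this
  · rw [rejects_iff]
    constructor
    · intro h m
      -- The value at `U = 0` for the message `m` must also occur for the message `0`, whose shares
      -- are of the form `G u`.
      have h0 : (fun i : B => (F *ᵥ m) i) ∈ (cssMarginal G F B m).support := by
        rw [cssMarginal_eq_map, PMF.support_map]
        exact ⟨0, by simp, by ext; simp⟩
      rw [h m 0, cssMarginal_eq_map, PMF.support_map] at h0
      obtain ⟨u, -, hu⟩ := h0
      refine ⟨u, fun i hi => ?_⟩
      have := congrFun hu ⟨i, hi⟩
      simpa using this.symm
    · intro h m m'
      obtain ⟨u, hu⟩ := h (m - m')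
      exact cssMarginal_congr G F B hu

end Classical

/-! ### Perfect discrimination by measurements -/

section POVM

variable {S X : Type*} [Fintype S] [DecidableEq S] [Fintype X]

/-- A Hermitian matrix has a commuting Hermitian pseudo-inverse. -/
theorem exists_hermitian_pseudoinverse {A : Matrix S S ℂ} (hA : A.IsHermitian) :
    ∃ R : Matrix S S ℂ, R.IsHermitian ∧ A * R = R * A ∧ A * R * A = A := by
  set φ := Unitary.conjStarAlgAut ℂ (Matrix S S ℂ) hA.eigenvectorUnitary with hφ
  set D : Matrix S S ℂ := Matrix.diagonal (RCLike.ofReal ∘ hA.eigenvalues) with hD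
  -- The convention `0⁻¹ = 0` makes this a pseudo-inverse on the kernel as well.
  set E : Matrix S S ℂ := Matrix.diagonal (RCLike.ofReal ∘ hA.eigenvalues⁻¹) with hE
  have hAD : A = φ D := hA.spectral_theorem
  refine ⟨φ E, ?_, ?_, ?_⟩
  · have hEE : star E = E := by
      rw [hE, Matrix.star_eq_conjTranspose, Matrix.diagonal_conjTranspose]
      congr 1
      ext i
      simp
    rw [Matrix.IsHermitian, ← Matrix.star_eq_conjTranspose, ← map_star, hEE]
  · rw [hAD, ← map_mul, ← map_mul, hD, hE, Matrix.diagonal_mul_diagonal,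
      Matrix.diagonal_mul_diagonal]
    simp_rw [mul_comm]
  · conv_lhs => rw [hAD]
    rw [← map_mul, ← map_mul, hD, hE, Matrix.diagonal_mul_diagonal,
      Matrix.diagonal_mul_diagonal]
    conv_rhs => rw [hAD, hD]
    congr 2
    ext i
    simp only [Function.comp, Pi.inv_apply]
    by_cases h : hA.eigenvalues i = 0
    · simp [h]
    · have : ((hA.eigenvalues i : ℝ) : ℂ) ≠ 0 := by exact_mod_cast h
      simp [this]

/-- Mutually orthogonal positive semidefinite matrices are distinguished by a POVM. -/
theorem exists_isPOVM_of_orthogonal [Nonempty X] {ρ : X → Matrix S S ℂ}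
    (hρ : ∀ x, (ρ x).PosSemidef) (ho : ∀ x y, x ≠ y → ρ x * ρ y = 0) :
    ∃ P : X → Matrix S S ℂ, IsPOVM P ∧ ∀ x, ρ x * P x = ρ x := by
  classical
  choose R hR hcomm hRR using fun x => exists_hermitian_pseudoinverse (hρ x).isHermitian
  -- These are the support projections of the `ρ x`.
  set Q : X → Matrix S S ℂ := fun x => ρ x * R x with hQ
  have hQh : ∀ x, (Q x)ᴴ = Q x := fun x => by
    simp only [hQ]
    rw [Matrix.conjTranspose_mul, (hR x).eq, (hρ x).isHermitian.eq, hcomm]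
  have hQQ : ∀ x y, Q x * Q y = if x = y then Q x else 0 := by
    intro x y
    split_ifs with h
    · subst h
      simp only [hQ]
      rw [← mul_assoc, hRR]
    · simp only [hQ]
      rw [hcomm x, mul_assoc, ← mul_assoc (ρ x), ho x y h, zero_mul, mul_zero]
  have hρQ : ∀ x y, ρ x * Q y = if x = y then ρ x else 0 := by
    intro x y
    split_ifs with h
    · subst h
      simp only [hQ]
      rw [hcomm, ← mul_assoc, hRR]
    · simp only [hQ]
      rw [← mul_assoc, ho x y h, zero_mul]
  have hpsd : ∀ T : Matrix S S ℂ, Tᴴ = T → T * T = T → T.PosSemidef := fun T h1 h2 => by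
    have := Matrix.posSemidef_conjTranspose_mul_self T
    rwa [h1, h2] at this
  have hrest : (1 - ∑ x, Q x).PosSemidef := by
    refine hpsd _ ?_ ?_
    · simp [Matrix.conjTranspose_sum, hQh]
    · have : (∑ x, Q x) * ∑ x, Q x = ∑ x, Q x := by
        simp [Finset.sum_mul, Finset.mul_sum, hQQ]
      rw [sub_mul, mul_sub, mul_sub, this]
      simp
  obtain ⟨x₀⟩ := ‹Nonempty X›
  -- The projection onto the complement of all supports goes to an arbitrary outcome `x₀`; every `ρ
  -- x` annihilates it.
  refine ⟨fun x => Q x + if x = x₀ then 1 - ∑ y, Q y else 0, ⟨fun x => ?_, ?_⟩, fun x => ?_⟩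
  · refine (hpsd _ (hQh x) (by simp [hQQ])).add ?_
    split_ifs
    · exact hrest
    · exact Matrix.PosSemidef.zero
  · simp [Finset.sum_add_distrib]
  · have h0 : ρ x * (1 - ∑ y, Q y) = 0 := by
      simp [mul_sub, Finset.mul_sum, hρQ]
    rw [mul_add, hρQ, if_pos rfl]
    split_ifs
    · rw [h0, add_zero]
    · rw [mul_zero, add_zero]

omit [DecidableEq S] in
theorem trace_vecMulVec_mul (a b : S → ℂ) (E : Matrix S S ℂ) :
    (Matrix.vecMulVec a b * E).trace = b ⬝ᵥ E *ᵥ a := by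
  rw [Matrix.vecMulVec_mul, Matrix.trace_vecMulVec, dotProduct_comm, Matrix.dotProduct_mulVec]

/-- A POVM that detects with certainty each member of a complete family of unit vectors
consists of the projections onto these vectors. -/
theorem IsPOVM.eq_vecMulVec {E : X → Matrix S S ℂ} (hE : IsPOVM E) {φ : X → S → ℂ}
    (hnorm : ∀ x, star (φ x) ⬝ᵥ φ x = 1)
    (hcomp : ∑ x, Matrix.vecMulVec (φ x) (star (φ x)) = 1)
    (hdet : ∀ x, (Matrix.vecMulVec (φ x) (star (φ x)) * E x).trace = 1) (x : X) :
    E x = Matrix.vecMulVec (φ x) (star (φ x)) := by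
  classical
  simp only [trace_vecMulVec_mul] at hdet
  have hzero : ∀ y z, z ≠ y → E z *ᵥ φ y = 0 := by
    intro y z hzy
    rw [← (hE.1 z).dotProduct_mulVec_zero_iff]
    -- The outcome probabilities at `φ y` are nonnegative and sum to 1, and outcome `y` already has
    -- probability 1, so all others vanish.
    have hsum : ∑ z, star (φ y) ⬝ᵥ E z *ᵥ φ y = 1 := by
      rw [← dotProduct_sum, ← Matrix.sum_mulVec, hE.2, Matrix.one_mulVec, hnorm]
    rw [← Finset.add_sum_erase _ _ (Finset.mem_univ y), hdet, add_eq_left,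
      Finset.sum_eq_zero_iff_of_nonneg fun z _ => (hE.1 z).dotProduct_mulVec_nonneg _] at hsum
    exact hsum z (by simp [hzy])
  have hself : E x *ᵥ φ x = φ x := by
    conv_rhs => rw [← Matrix.one_mulVec (φ x), ← hE.2, Matrix.sum_mulVec]
    rw [Finset.sum_eq_single x (fun z _ h => hzero x z h) (by simp)]
  calc E x = E x * ∑ y, Matrix.vecMulVec (φ y) (star (φ y)) := by rw [hcomp, mul_one]
    _ = ∑ y, Matrix.vecMulVec (E x *ᵥ φ y) (star (φ y)) := by
        simp_rw [Finset.mul_sum, Matrix.mul_vecMulVec]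
    _ = _ := by
        rw [Finset.sum_eq_single x, hself]
        · intro y _ h
          rw [hzero y x h.symm, Matrix.zero_vecMulVec]
        · simp

end POVM

/-! ### Kraus representations of channels -/

section Kraus

variable {S T κ : Type*} [Fintype S] [Fintype T] [Fintype κ] [DecidableEq S]

/-- The completely positive map with Kraus operators `L k`. -/
def krausMap (L : κ → Matrix T S ℂ) : Matrix S S ℂ →ₗ[ℂ] Matrix T T ℂ where
  toFun ρ := ∑ k, L k * ρ * (L k)ᴴ
  map_add' ρ σ := by simp [Matrix.mul_add, Matrix.add_mul, Finset.sum_add_distrib]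
  map_smul' c ρ := by simp [Finset.smul_sum]

omit [Fintype T] [DecidableEq S] in
theorem krausMap_apply (L : κ → Matrix T S ℂ) (ρ : Matrix S S ℂ) :
    krausMap L ρ = ∑ k, L k * ρ * (L k)ᴴ := rfl

omit [Fintype T] [DecidableEq S] in
theorem ampliation_krausMap (L : κ → Matrix T S ℂ) (d : ℕ)
    (ρ : Matrix (S × Fin d) (S × Fin d) ℂ) :
    ampliation (krausMap L) d ρ =
      ∑ k, (L k ⊗ₖ (1 : Matrix (Fin d) (Fin d) ℂ)) * ρ *
        (L k ⊗ₖ (1 : Matrix (Fin d) (Fin d) ℂ))ᴴ := by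
  ext ⟨t, i⟩ ⟨t', j⟩
  simp only [ampliation, krausMap_apply, Matrix.of_apply, Matrix.sum_apply]
  refine Finset.sum_congr rfl fun k _ => ?_
  simp [Matrix.mul_apply, Fintype.sum_prod_type, Matrix.one_apply, Finset.sum_mul, apply_ite (starRingEnd ℂ)]

theorem trace_krausMap {L : κ → Matrix T S ℂ} (hL : ∑ k, (L k)ᴴ * L k = 1) (ρ : Matrix S S ℂ) :
    (krausMap L ρ).trace = ρ.trace := by
  rw [krausMap_apply, Matrix.trace_sum]
  have h : ∀ k, (L k * ρ * (L k)ᴴ).trace = (ρ * ((L k)ᴴ * L k)).trace := fun k => by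
    rw [Matrix.mul_assoc, Matrix.trace_mul_comm, Matrix.mul_assoc]
  simp_rw [h]
  rw [← Matrix.trace_sum, ← Matrix.mul_sum, hL, mul_one]

theorem isTPCP_krausMap {L : κ → Matrix T S ℂ} (hL : ∑ k, (L k)ᴴ * L k = 1) :
    IsTPCP (krausMap L) := by
  refine ⟨krausMap L, fun _ => rfl, fun ρ hρ => ?_, fun d ρ hρ => ?_⟩
  · rw [trace_krausMap hL, hρ.2]
  · rw [ampliation_krausMap]
    exact Matrix.posSemidef_sum _ fun k _ => hρ.1.mul_mul_conjTranspose_same _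

end Kraus

/-! ### Teleportation and orthogonal families of unitaries -/

section Teleportation

variable {B L κ X : Type*} [Fintype B] [Fintype L] [Fintype κ] [Fintype X]
  [DecidableEq B] [DecidableEq L]

/-- The operator left on the third system when the outcome with effect `P` occurs in a measurement
of `ρ` together with one half of a maximally entangled pair. -/
def teleportResidue (P : Matrix (B × L) (B × L) ℂ) (ρ : Matrix B B ℂ) : Matrix L L ℂ :=
  Matrix.of fun t t' => (Fintype.card L : ℂ)⁻¹ * ((ρ ⊗ₖ Matrix.single t t' 1) * P).trace

omit [DecidableEq B] in
theorem trace_kronecker_single_mul (P : Matrix (B × L) (B × L) ℂ) (ρ : Matrix B B ℂ) (t t' : L) :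
    ((ρ ⊗ₖ Matrix.single t t' 1) * P).trace = ∑ b, ∑ b', ρ b b' * P (b', t') (b, t) := by
  simp [Matrix.trace, Matrix.mul_apply, Fintype.sum_prod_type, Matrix.single_apply, ite_and]

omit [DecidableEq L] in
theorem inv_sqrt_card_mul_self :
    ((Real.sqrt (Fintype.card L) : ℝ) : ℂ)⁻¹ * ((Real.sqrt (Fintype.card L) : ℝ) : ℂ)⁻¹ =
      (Fintype.card L : ℂ)⁻¹ := by
  rw [← mul_inv, ← Complex.ofReal_mul, Real.mul_self_sqrt (Nat.cast_nonneg _),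
    Complex.ofReal_natCast]

omit [DecidableEq L] in
theorem conj_inv_sqrt_card :
    (starRingEnd ℂ) ((Real.sqrt (Fintype.card L) : ℝ) : ℂ)⁻¹ =
      ((Real.sqrt (Fintype.card L) : ℝ) : ℂ)⁻¹ := by
  rw [map_inv₀, Complex.conj_ofReal]

-- With `P x = QᴴQ`, each row of `Q`, reshaped into an operator from `B` to `L`, contributes one
-- Kraus operator, which makes complete positivity visible.
omit [DecidableEq B] in
theorem sum_conj_teleportResidue_eq_krausMap {U : X → Matrix L L ℂ}
    {P Q : X → Matrix (B × L) (B × L) ℂ} (hPQ : ∀ x, P x = (Q x)ᴴ * Q x) (ρ : Matrix B B ℂ) :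
    ∑ x, U x * teleportResidue (P x) ρ * (U x)ᴴ =
      krausMap (fun k : X × B × L => ((Real.sqrt (Fintype.card L) : ℝ) : ℂ)⁻¹ •
        (U k.1 * Matrix.of fun a b => Q k.1 k.2 (b, a))) ρ := by
  rw [krausMap_apply, Fintype.sum_prod_type]
  refine Finset.sum_congr rfl fun x _ => ?_
  have key : teleportResidue (P x) ρ = ∑ k : B × L, (Fintype.card L : ℂ)⁻¹ •
      ((Matrix.of fun a b => Q x k (b, a)) * ρ * (Matrix.of fun a b => Q x k (b, a))ᴴ) := by
    ext t t'
    simp only [teleportResidue, Matrix.of_apply, trace_kronecker_single_mul, hPQ, Matrix.mul_apply,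
      Matrix.sum_apply, Matrix.smul_apply, smul_eq_mul, Matrix.conjTranspose_apply,
      Finset.mul_sum, Finset.sum_mul]
    simp_rw [Finset.sum_comm (s := (Finset.univ : Finset B)) (t := (Finset.univ : Finset (B × L)))]
    refine Finset.sum_congr rfl fun k _ => ?_
    rw [Finset.sum_comm]
    refine Finset.sum_congr rfl fun b _ => Finset.sum_congr rfl fun b' _ => ?_
    ring
  rw [key, Matrix.mul_sum, Matrix.sum_mul]
  refine Finset.sum_congr rfl fun k _ => ?_
  simp only [Matrix.conjTranspose_smul, Matrix.conjTranspose_mul, Matrix.smul_mul, Matrix.mul_smul,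
    smul_smul, ← inv_sqrt_card_mul_self, RCLike.star_def, conj_inv_sqrt_card, Matrix.mul_assoc]

/-- Measuring the given system together with one half of a maximally entangled pair, followed by a
unitary that depends on the outcome, is a trace-preserving completely positive map. -/
theorem isTPCP_sum_conj_teleportResidue [Nonempty L] {U : X → Matrix L L ℂ}
    (hU : ∀ x, (U x)ᴴ * U x = 1) {P : X → Matrix (B × L) (B × L) ℂ} (hP : IsPOVM P) :
    IsTPCP fun ρ => ∑ x, U x * teleportResidue (P x) ρ * (U x)ᴴ := by
  have : ∀ x, ∃ Q, P x = Qᴴ * Q := fun x => by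
    open scoped MatrixOrder in
    exact CStarAlgebra.nonneg_iff_eq_star_mul_self.mp (hP.1 x).nonneg
  choose Q hPQ using this
  simp_rw [sum_conj_teleportResidue_eq_krausMap hPQ]
  refine isTPCP_krausMap ?_
  have hcard : (Fintype.card L : ℂ) ≠ 0 := by simp
  have h1 : ∀ k : X × B × L, (((Real.sqrt (Fintype.card L) : ℝ) : ℂ)⁻¹ •
        (U k.1 * Matrix.of fun a b => Q k.1 k.2 (b, a)))ᴴ *
      (((Real.sqrt (Fintype.card L) : ℝ) : ℂ)⁻¹ •
        (U k.1 * Matrix.of fun a b => Q k.1 k.2 (b, a))) =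
      (Fintype.card L : ℂ)⁻¹ • ((Matrix.of fun a b => Q k.1 k.2 (b, a))ᴴ *
        Matrix.of fun a b => Q k.1 k.2 (b, a)) := fun k => by
    simp only [Matrix.conjTranspose_smul, Matrix.conjTranspose_mul, Matrix.smul_mul,
      Matrix.mul_smul, smul_smul, RCLike.star_def, conj_inv_sqrt_card, inv_sqrt_card_mul_self]
    rw [Matrix.mul_assoc, ← Matrix.mul_assoc _ (U k.1), hU, Matrix.one_mul]
  simp_rw [h1]
  rw [← Finset.smul_sum, inv_smul_eq_iff₀ hcard]
  ext b b'
  -- Each of the `|L|` values of `a` contributes one identity matrix; together they cancel the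
  -- normalization.
  have h2 : ∀ a, ∑ x, (P x) (b, a) (b', a) = (1 : Matrix B B ℂ) b b' := fun a => by
    rw [← Matrix.sum_apply, hP.2]
    simp [Matrix.one_apply]
  calc _ = ∑ k : X × B × L, ∑ a, star (Q k.1 k.2 (b, a)) * Q k.1 k.2 (b', a) := by
        simp [Matrix.sum_apply, Matrix.mul_apply]
    _ = ∑ a, ∑ x, (P x) (b, a) (b', a) := by
        rw [Finset.sum_comm]
        refine Finset.sum_congr rfl fun a _ => ?_
        rw [Fintype.sum_prod_type]
        refine Finset.sum_congr rfl fun x _ => ?_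
        simp [hPQ, Matrix.mul_apply]
    _ = _ := by simp [h2]

omit [DecidableEq B] in
/-- Applying Kraus operators to the first system pulls back to the effects. -/
theorem trace_sum_kronecker_one_mul (K : κ → Matrix B L ℂ) (Z : Matrix (L × L) (L × L) ℂ)
    (P : Matrix (B × L) (B × L) ℂ) :
    ((∑ k, (K k ⊗ₖ (1 : Matrix L L ℂ)) * Z * (K k ⊗ₖ (1 : Matrix L L ℂ))ᴴ) * P).trace =
      (Z * ∑ k, (K k ⊗ₖ (1 : Matrix L L ℂ))ᴴ * P * (K k ⊗ₖ (1 : Matrix L L ℂ))).trace := by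
  rw [Matrix.sum_mul, Matrix.mul_sum, Matrix.trace_sum, Matrix.trace_sum]
  refine Finset.sum_congr rfl fun k _ => ?_
  rw [Matrix.mul_assoc, Matrix.mul_assoc, Matrix.trace_mul_comm, Matrix.mul_assoc]

omit [Fintype B] [DecidableEq B] in
theorem krausMap_kronecker (K : κ → Matrix B L ℂ) (Z Y : Matrix L L ℂ) :
    krausMap K Z ⊗ₖ Y =
      ∑ k, (K k ⊗ₖ (1 : Matrix L L ℂ)) * (Z ⊗ₖ Y) * (K k ⊗ₖ (1 : Matrix L L ℂ))ᴴ := by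
  ext ⟨b, l⟩ ⟨b', l'⟩
  simp only [krausMap_apply, Matrix.conjTranspose_kronecker, ← Matrix.mul_kronecker_mul,
    Matrix.conjTranspose_one, Matrix.one_mul, Matrix.mul_one, Matrix.sum_apply,
    Matrix.kroneckerMap_apply, Finset.sum_mul]

/-- The maximally entangled vector with `U` applied to its first half. -/
def entangledVec {S : Type*} (U : Matrix S L ℂ) : S × L → ℂ :=
  fun ab => ((Real.sqrt (Fintype.card L) : ℝ) : ℂ)⁻¹ * U ab.1 ab.2

omit [DecidableEq L] in
theorem star_entangledVec_dotProduct (U W : Matrix L L ℂ) :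
    star (entangledVec U) ⬝ᵥ entangledVec W = (Fintype.card L : ℂ)⁻¹ * (Uᴴ * W).trace := by
  simp only [dotProduct, entangledVec, Pi.star_apply, star_mul', RCLike.star_def,
    conj_inv_sqrt_card, Fintype.sum_prod_type, Matrix.trace, Matrix.diag, Matrix.mul_apply,
    Matrix.conjTranspose_apply, ← inv_sqrt_card_mul_self, Finset.mul_sum]
  rw [Finset.sum_comm]
  refine Finset.sum_congr rfl fun b _ => Finset.sum_congr rfl fun b' _ => ?_
  ring

/-- `|L|²` mutually orthogonal unitaries give a complete family of entangled vectors. -/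
theorem sum_vecMulVec_entangledVec [Nonempty L] {U : X → Matrix L L ℂ}
    (hU : ∀ x, (U x)ᴴ * U x = 1) (ho : ∀ x y, x ≠ y → ((U x)ᴴ * U y).trace = 0)
    (hcard : Fintype.card X = Fintype.card (L × L)) :
    ∑ x, Matrix.vecMulVec (entangledVec (U x)) (star (entangledVec (U x))) = 1 := by
  classical
  obtain ⟨e⟩ := Fintype.card_eq.mp hcard
  -- Since `|X| = |L|²`, the matrix with these orthonormal columns is square, so its rows are
  -- orthonormal too, which is completeness.
  set T : Matrix (L × L) (L × L) ℂ := Matrix.of fun ab c => entangledVec (U (e.symm c)) ab with hT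
  have hL : (Fintype.card L : ℂ) ≠ 0 := by simp
  have h1 : Tᴴ * T = 1 := by
    ext c c'
    have : (Tᴴ * T) c c' =
      star (entangledVec (U (e.symm c))) ⬝ᵥ entangledVec (U (e.symm c')) := rfl
    rw [this, star_entangledVec_dotProduct, Matrix.one_apply]
    split_ifs with h
    · rw [h, hU, Matrix.trace_one, inv_mul_cancel₀ hL]
    · rw [ho _ _ (by simpa using h), mul_zero]
  rw [← mul_eq_one_comm.mp h1, ← e.symm.sum_comp]
  ext a b
  simp [Matrix.sum_apply, Matrix.mul_apply, Matrix.vecMulVec_apply, hT]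

/-- If a POVM on the output of a channel and a reference system discriminates a complete orthogonal
family of maximally entangled states, then teleportation with this POVM inverts the channel. -/
theorem sum_conj_teleportResidue_krausMap [Nonempty L] {U : X → Matrix L L ℂ}
    (hU : ∀ x, (U x)ᴴ * U x = 1) (ho : ∀ x y, x ≠ y → ((U x)ᴴ * U y).trace = 0)
    (hcard : Fintype.card X = Fintype.card (L × L)) {K : κ → Matrix B L ℂ}
    (hK : ∑ k, (K k)ᴴ * K k = 1) {P : X → Matrix (B × L) (B × L) ℂ} (hP : IsPOVM P)
    (hdet : ∀ x, ((∑ k, (K k ⊗ₖ (1 : Matrix L L ℂ)) *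
      Matrix.vecMulVec (entangledVec (U x)) (star (entangledVec (U x))) *
      (K k ⊗ₖ (1 : Matrix L L ℂ))ᴴ) * P x).trace = 1) (ρ : Matrix L L ℂ) :
    ∑ x, U x * teleportResidue (P x) (krausMap K ρ) * (U x)ᴴ = ρ := by
  have hL : (Fintype.card L : ℂ) ≠ 0 := by simp
  -- The measurement is moved back through the channel in the Heisenberg picture; certain detection
  -- then forces it to be the Bell measurement of the `U x`.
  set E : X → Matrix (L × L) (L × L) ℂ := fun x =>
    ∑ k, (K k ⊗ₖ (1 : Matrix L L ℂ))ᴴ * P x * (K k ⊗ₖ (1 : Matrix L L ℂ)) with hE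
  have hEP : IsPOVM E := by
    refine ⟨fun x => Matrix.posSemidef_sum _ fun k _ => (hP.1 x).conjTranspose_mul_mul_same _, ?_⟩
    simp only [hE]
    rw [Finset.sum_comm]
    simp_rw [← Matrix.sum_mul, ← Matrix.mul_sum, hP.2, Matrix.mul_one,
      Matrix.conjTranspose_kronecker, ← Matrix.mul_kronecker_mul]
    have := congrArg (fun M => M ⊗ₖ (1 : Matrix L L ℂ)) hK
    simp only [Matrix.one_kronecker_one] at this
    rw [← this]
    ext ⟨b, l⟩ ⟨b', l'⟩
    simp [Matrix.sum_apply, Finset.sum_mul]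
  simp only [trace_sum_kronecker_one_mul] at hdet
  have hEx := hEP.eq_vecMulVec (fun x => by
    rw [star_entangledVec_dotProduct, hU, Matrix.trace_one, inv_mul_cancel₀ hL])
    (sum_vecMulVec_entangledVec hU ho hcard) hdet
  have hres : ∀ x, teleportResidue (P x) (krausMap K ρ) =
      ((Fintype.card L : ℂ)⁻¹ * (Fintype.card L : ℂ)⁻¹) • ((U x)ᴴ * ρ * U x) := by
    intro x
    ext t t'
    simp only [teleportResidue, Matrix.of_apply]
    rw [krausMap_kronecker, trace_sum_kronecker_one_mul]
    change _ * (_ * E x).trace = _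
    rw [hEx, trace_kronecker_single_mul]
    simp only [Matrix.vecMulVec_apply, entangledVec, Pi.star_apply, star_mul', RCLike.star_def,
      conj_inv_sqrt_card, Matrix.smul_apply, smul_eq_mul, Matrix.mul_apply,
      Matrix.conjTranspose_apply, mul_assoc]
    congr 1
    rw [← inv_sqrt_card_mul_self]
    simp only [Finset.mul_sum]
    refine Finset.sum_congr rfl fun b _ => Finset.sum_congr rfl fun b' _ => ?_
    ring
  -- The correction undoes the residual conjugation, so each of the `|L|²` outcomes returns `|L|⁻²
  -- ρ`.
  have hterm : ∀ x, U x * teleportResidue (P x) (krausMap K ρ) * (U x)ᴴ =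
      ((Fintype.card L : ℂ)⁻¹ * (Fintype.card L : ℂ)⁻¹) • ρ := fun x => by
    have h2 := mul_eq_one_comm.mp (hU x)
    rw [hres, Matrix.mul_smul, Matrix.smul_mul, mul_assoc, mul_assoc, h2, mul_one, ← mul_assoc,
      h2, one_mul]
  simp_rw [hterm]
  rw [Finset.sum_const, Finset.card_univ, hcard, Fintype.card_prod, ← Nat.cast_smul_eq_nsmul ℂ,
    smul_smul, Nat.cast_mul]
  field_simp
  rw [one_smul]

/-- Averaging over a complete orthogonal family of unitaries depolarizes. -/
theorem sum_conj_eq_trace_smul_one [Nonempty L] {U : X → Matrix L L ℂ}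
    (hU : ∀ x, (U x)ᴴ * U x = 1) (ho : ∀ x y, x ≠ y → ((U x)ᴴ * U y).trace = 0)
    (hcard : Fintype.card X = Fintype.card (L × L)) (ρ : Matrix L L ℂ) :
    ∑ x, U x * ρ * (U x)ᴴ = ((Fintype.card L : ℂ) * ρ.trace) • 1 := by
  have hL : (Fintype.card L : ℂ) ≠ 0 := by simp
  have h := sum_vecMulVec_entangledVec hU ho hcard
  -- This is completeness of the entangled vectors, entry by entry; the factor `|L|` undoes their
  -- normalization.
  have h' : ∀ a b x y, ∑ z, U z a x * star (U z b y) =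
      (Fintype.card L : ℂ) * if a = b ∧ x = y then 1 else 0 := by
    intro a b x y
    have := congrFun₂ h (a, x) (b, y)
    simp only [Matrix.sum_apply, Matrix.vecMulVec_apply, entangledVec, Pi.star_apply, star_mul',
      RCLike.star_def, conj_inv_sqrt_card, Matrix.one_apply, Prod.mk.injEq] at this
    rw [← this, Finset.mul_sum]
    refine Finset.sum_congr rfl fun z _ => ?_
    have h3 := inv_sqrt_card_mul_self (L := L)
    rw [RCLike.star_def]
    calc _ = (Fintype.card L : ℂ) * (Fintype.card L : ℂ)⁻¹ *
        (U z a x * (starRingEnd ℂ) (U z b y)) := by rw [mul_inv_cancel₀ hL, one_mul]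
      _ = _ := by rw [← h3]; ring
  ext a b
  calc _ = ∑ y, ∑ x, ρ x y * ∑ z, U z a x * star (U z b y) := by
        simp only [Matrix.sum_apply, Matrix.mul_apply, Matrix.conjTranspose_apply, Finset.sum_mul,
          Finset.mul_sum]
        rw [Finset.sum_comm]
        refine Finset.sum_congr rfl fun y _ => ?_
        rw [Finset.sum_comm]
        refine Finset.sum_congr rfl fun x _ => Finset.sum_congr rfl fun z _ => ?_
        ring
    _ = _ := by
        simp only [h', Matrix.smul_apply, Matrix.one_apply, smul_eq_mul, Matrix.trace,
          Matrix.diag]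
        by_cases hab : a = b <;> simp [hab, Finset.mul_sum, mul_comm]

end Teleportation

/-! ### The symplectic form and Weyl operators -/

section Weyl

variable (p : ℕ) [Fact p.Prime] {K : Type*} [Field K] [Fintype K] [DecidableEq K]
  [Algebra (ZMod p) K] {ι : Type*} [Fintype ι]

/-- The additive character `x ↦ ω^{tr x}`. -/
def traceChar : AddChar K ℂ :=
  (ZMod.stdAddChar (N := p)).compAddMonoidHom (Algebra.trace (ZMod p) K).toAddMonoidHom

omit [Fintype K] [DecidableEq K] in
theorem traceChar_apply (x : K) :
    traceChar p x = ZMod.stdAddChar (Algebra.trace (ZMod p) K x) := rfl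

omit [Fintype K] [DecidableEq K] in
theorem symp_swap (v w : ι ⊕ ι → K) : symp p v w = -symp p w v := by
  simp [symp]

omit [Fintype K] [DecidableEq K] in
theorem symp_add_left (v v' w : ι ⊕ ι → K) : symp p (v + v') w = symp p v w + symp p v' w := by
  simp only [symp, Pi.add_apply, add_mul, mul_add, Finset.sum_add_distrib, map_add]
  ring

omit [Fintype K] [DecidableEq K] in
theorem symp_sub_left (v v' w : ι ⊕ ι → K) : symp p (v - v') w = symp p v w - symp p v' w := by
  rw [eq_sub_iff_add_eq, ← symp_add_left, sub_add_cancel]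

omit [DecidableEq K] in
/-- The symplectic form separates a subspace from the vectors outside of it. -/
theorem exists_symp_ne_zero {N : Submodule K (ι ⊕ ι → K)} {w : ι ⊕ ι → K} (hw : w ∉ N) :
    ∃ v, symp p w v ≠ 0 ∧ ∀ u ∈ N, symp p u v = 0 := by
  classical
  obtain ⟨f, hfw, hfN⟩ := Submodule.exists_le_ker_of_notMem hw
  -- The form takes values in `𝔽_p`, so `f w ≠ 0` is not enough: a scalar moves it off the kernel of
  -- the trace, while multiples of `f` still vanish on the `𝔽_q`-subspace `N`.
  obtain ⟨c, hc⟩ : ∃ c, Algebra.trace (ZMod p) K (f w * c) ≠ 0 := by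
    have h := (traceForm_nondegenerate (ZMod p) K).1 (f w)
    simp_rw [Algebra.traceForm_apply] at h
    by_contra! hf
    exact hfw (h hf)
  have hf : ∀ x, f x = ∑ i, x (Sum.inl i) * f (Pi.single (Sum.inl i) 1) +
      ∑ i, x (Sum.inr i) * f (Pi.single (Sum.inr i) 1) := fun x => by
    conv_lhs => rw [pi_eq_sum_univ' x]
    simp [Fintype.sum_sum_type]
  set v : ι ⊕ ι → K := Sum.elim (fun i => -(f (Pi.single (Sum.inr i) 1) * c))
    (fun i => f (Pi.single (Sum.inl i) 1) * c) with hv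
  have key : ∀ x, symp p x v = Algebra.trace (ZMod p) K (f x * c) := fun x => by
    rw [symp, ← map_sub, hf x, add_mul, Finset.sum_mul, Finset.sum_mul, sub_eq_add_neg,
      ← Finset.sum_neg_distrib]
    congr 2 <;> refine Finset.sum_congr rfl fun i _ => ?_ <;> simp [hv] <;> ring
  refine ⟨v, by rwa [key], fun u hu => ?_⟩
  rw [key, LinearMap.mem_ker.mp (hfN hu), zero_mul, map_zero]

theorem weyl_apply [DecidableEq ι] (w : ι ⊕ ι → K) (x y : ι → K) :
    weyl p w x y = if x = y + w ∘ Sum.inl then traceChar p (∑ i, w (Sum.inr i) * y i) else 0 := by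
  have h : ∀ i, (shiftX (w (Sum.inl i)) * phaseZ p (w (Sum.inr i))) (x i) (y i) =
      if x i = y i + w (Sum.inl i) then traceChar p (w (Sum.inr i) * y i) else 0 := fun i => by
    simp [shiftX, phaseZ, Matrix.mul_diagonal, traceChar_apply]
  simp only [weyl, Matrix.of_apply, h]
  split_ifs with hxy
  · have hsum : traceChar p (∑ i, w (Sum.inr i) * y i) =
        ∏ i, traceChar p (w (Sum.inr i) * y i) :=
      map_prod (traceChar p).toMonoidHom (fun i => Multiplicative.ofAdd (w (Sum.inr i) * y i)) _
    rw [hsum]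
    refine Finset.prod_congr rfl fun i _ => ?_
    exact if_pos (congrFun hxy i)
  · obtain ⟨i, hi⟩ := Function.ne_iff.mp hxy
    exact Finset.prod_eq_zero (Finset.mem_univ i) (if_neg hi)

variable [DecidableEq ι]

/-- The phase arises from moving the `Z` part of `v` past the `X` part of `w`. -/
theorem weyl_mul (v w : ι ⊕ ι → K) :
    weyl p v * weyl p w =
      traceChar p (∑ i, v (Sum.inr i) * w (Sum.inl i)) • weyl p (v + w) := by
  ext x y
  rw [Matrix.mul_apply, Finset.sum_eq_single (y + w ∘ Sum.inl)]
  · simp only [weyl_apply, if_true, Matrix.smul_apply, smul_eq_mul]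
    have h : x = y + w ∘ Sum.inl + v ∘ Sum.inl ↔ x = y + (v + w) ∘ Sum.inl := by
      rw [add_assoc, add_comm (w ∘ _)]; rfl
    simp only [h, ite_mul, zero_mul, mul_ite, mul_zero]
    congr 1
    rw [← AddChar.map_add_eq_mul, ← AddChar.map_add_eq_mul, ← Finset.sum_add_distrib,
      ← Finset.sum_add_distrib]
    congr 1
    refine Finset.sum_congr rfl fun i _ => ?_
    simp only [Pi.add_apply, Function.comp]
    ring
  · intro z _ hz
    rw [weyl_apply p w, if_neg hz, mul_zero]
  · simp

theorem weyl_zero : weyl p (0 : ι ⊕ ι → K) = 1 := by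
  ext x y
  simp only [weyl_apply, Matrix.one_apply]
  simp

/-- The Weyl operators commute up to the phase given by the symplectic form. -/
theorem weyl_mul_comm (v w : ι ⊕ ι → K) :
    weyl p v * weyl p w = ZMod.stdAddChar (symp p w v) • (weyl p w * weyl p v) := by
  rw [weyl_mul, weyl_mul, smul_smul, add_comm w v]
  congr 1
  rw [symp, traceChar_apply, traceChar_apply, ← AddChar.map_add_eq_mul]
  congr 1
  simp_rw [mul_comm (w (Sum.inl _))]
  simp_rw [mul_comm (v (Sum.inl _))]
  ring

theorem conjTranspose_weyl_mul_self (w : ι ⊕ ι → K) : (weyl p w)ᴴ * weyl p w = 1 := by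
  ext x y
  rw [Matrix.mul_apply, Finset.sum_eq_single (x + w ∘ Sum.inl)]
  · rw [Matrix.conjTranspose_apply, weyl_apply, if_pos rfl, weyl_apply, Matrix.one_apply]
    by_cases h : x = y
    · subst h
      simp [RCLike.star_def, ← Complex.normSq_eq_conj_mul_self, Complex.normSq_eq_norm_sq]
    · rw [if_neg (by simpa using h), if_neg h, mul_zero]
  · intro z _ hz
    rw [Matrix.conjTranspose_apply, weyl_apply, if_neg hz, star_zero, zero_mul]
  · simp

omit [Fintype K] [DecidableEq K] in
theorem traceChar_mul_star (x : K) : traceChar p x * star (traceChar p x) = 1 := by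
  rw [RCLike.star_def, mul_comm, ← Complex.normSq_eq_conj_mul_self, Complex.normSq_eq_norm_sq]
  simp [traceChar_apply]

/-- The phase in `weyl_mul` has modulus 1, so conjugation by Weyl operators is an honest action of
the additive group. -/
theorem weyl_add_conj (v w : ι ⊕ ι → K) (X : Matrix (ι → K) (ι → K) ℂ) :
    weyl p (v + w) * X * (weyl p (v + w))ᴴ =
      weyl p v * (weyl p w * X * (weyl p w)ᴴ) * (weyl p v)ᴴ := by
  have h : weyl p v * (weyl p w * X * (weyl p w)ᴴ) * (weyl p v)ᴴ =
      (weyl p v * weyl p w) * X * (weyl p v * weyl p w)ᴴ := by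
    simp only [Matrix.conjTranspose_mul, mul_assoc]
  rw [h, weyl_mul, Matrix.conjTranspose_smul, Matrix.smul_mul, Matrix.smul_mul, Matrix.mul_smul,
    smul_smul, traceChar_mul_star, one_smul]

/-- The phase stays unspecified because the result only serves to transfer the vanishing of a trace.
-/
theorem exists_conjTranspose_weyl_mul (v w : ι ⊕ ι → K) :
    ∃ c : ℂ, (weyl p v)ᴴ * weyl p w = c • weyl p (w - v) := by
  have h := weyl_mul p v (w - v)
  rw [add_sub_cancel] at h
  set c := traceChar p (∑ i, v (Sum.inr i) * (w - v) (Sum.inl i)) with hc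
  have hcc : star c * c = 1 := by rw [mul_comm]; exact traceChar_mul_star p _
  refine ⟨star c, ?_⟩
  have h2 : weyl p w = star c • (weyl p v * weyl p (w - v)) := by
    rw [h, smul_smul, hcc, one_smul]
  rw [h2, Matrix.mul_smul, ← mul_assoc, conjTranspose_weyl_mul_self, one_mul]

end Weyl

/-! ### Partial traces and local operators -/

section PartialTrace

variable {S T E : Type*} [Fintype S] [Fintype T] [Fintype E]

/-- The partial trace over the second factor. -/
def traceSnd (Y : Matrix (S × T) (S × T) ℂ) : Matrix S S ℂ :=
  Matrix.of fun s s' => ∑ t, Y (s, t) (s', t)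

theorem traceSnd_kronecker_one_mul [DecidableEq T] (M : Matrix S S ℂ)
    (Y : Matrix (S × T) (S × T) ℂ) : traceSnd ((M ⊗ₖ 1) * Y) = M * traceSnd Y := by
  ext s s'
  simp only [traceSnd, Matrix.of_apply, Matrix.mul_apply, Fintype.sum_prod_type,
    Matrix.kroneckerMap_apply, Matrix.one_apply, mul_ite, mul_one, mul_zero, ite_mul, zero_mul,
    Finset.sum_ite_eq, Finset.mem_univ, if_true, Finset.mul_sum]
  rw [Finset.sum_comm]

theorem traceSnd_mul_kronecker_one [DecidableEq T] (M : Matrix S S ℂ)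
    (Y : Matrix (S × T) (S × T) ℂ) : traceSnd (Y * (M ⊗ₖ 1)) = traceSnd Y * M := by
  ext s s'
  simp only [traceSnd, Matrix.of_apply, Matrix.mul_apply, Fintype.sum_prod_type,
    Matrix.kroneckerMap_apply, Matrix.one_apply, mul_ite, mul_one, mul_zero,
    Finset.sum_ite_eq', Finset.mem_univ, if_true, Finset.sum_mul]
  rw [Finset.sum_comm]

theorem traceSnd_one_kronecker_conj [DecidableEq S] [DecidableEq T] {N : Matrix T T ℂ}
    (hN : Nᴴ * N = 1) (Y : Matrix (S × T) (S × T) ℂ) :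
    traceSnd (((1 : Matrix S S ℂ) ⊗ₖ N) * Y * ((1 : Matrix S S ℂ) ⊗ₖ N)ᴴ) = traceSnd Y := by
  ext s s'
  set Z : Matrix T T ℂ := Matrix.of fun t t' => Y (s, t) (s', t') with hZ
  have h1 : traceSnd Y s s' = Z.trace := rfl
  have h2 : traceSnd (((1 : Matrix S S ℂ) ⊗ₖ N) * Y * ((1 : Matrix S S ℂ) ⊗ₖ N)ᴴ) s s' =
      (N * Z * Nᴴ).trace := by
    simp [traceSnd, Matrix.trace, Matrix.mul_apply, Fintype.sum_prod_type, hZ, Matrix.one_apply,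
      apply_ite (starRingEnd ℂ)]
  rw [h1, h2, Matrix.trace_mul_comm, ← mul_assoc, hN, one_mul]

end PartialTrace

/-! ### Splitting coordinates along a set of players -/

section Restriction

variable {K : Type*} {ι : Type*}

/-- The coordinates of `w` that belong to `A`. -/
def restr (A : Finset ι) (w : ι ⊕ ι → K) : A ⊕ A → K :=
  fun i => w (Sum.map Subtype.val Subtype.val i)

/-- The coordinates of `w` that do not belong to `A`. -/
def corestr (A : Finset ι) (w : ι ⊕ ι → K) : {i // i ∉ A} ⊕ {i // i ∉ A} → K :=
  fun i => w (Sum.map Subtype.val Subtype.val i)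

theorem restr_add [Add K] (A : Finset ι) (v w : ι ⊕ ι → K) :
    restr A (v + w) = restr A v + restr A w := rfl

theorem forall_mem_disjSum_iff (A : Finset ι) (v w : ι ⊕ ι → K) :
    (∀ i ∈ A.disjSum A, v i = w i) ↔ restr A v = restr A w := by
  simp [funext_iff, restr, Finset.mem_disjSum]

variable [DecidableEq ι]

/-- `glue` as an equivalence. -/
def glueEquiv (K : Type*) (A : Finset ι) : (A → K) × ({i // i ∉ A} → K) ≃ (ι → K) where
  toFun xz := glue A xz.1 xz.2
  invFun x := (fun i => x i, fun i => x i)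
  left_inv xz := by
    ext i
    · simp [glue]
    · simp [glue, i.2]
  right_inv x := by
    ext i
    simp [glue]

theorem glueEquiv_apply (A : Finset ι) (xz : (A → K) × ({i // i ∉ A} → K)) :
    glueEquiv K A xz = glue A xz.1 xz.2 := rfl

/-- The extension by zero of a vector supported on `A`. -/
def extend [Zero K] (A : Finset ι) (v : A ⊕ A → K) : ι ⊕ ι → K :=
  Sum.elim (glue A (v ∘ Sum.inl) 0) (glue A (v ∘ Sum.inr) 0)

theorem restr_extend [Zero K] (A : Finset ι) (v : A ⊕ A → K) : restr A (extend A v) = v := by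
  ext i
  rcases i with i | i <;> simp [restr, extend, glue]

theorem corestr_extend [Zero K] (A : Finset ι) (v : A ⊕ A → K) : corestr A (extend A v) = 0 := by
  ext i
  rcases i with i | i <;> simp [corestr, extend, glue, i.2]

end Restriction

/-! ### Partial traces of shares, block by block in the reference system -/

section PartialTraceShares

variable {K ι : Type*} [Fintype K] [Fintype ι] [DecidableEq ι] {E : Type*}

theorem reduceTo_eq_traceSnd (A : Finset ι) (X : Matrix (ι → K) (ι → K) ℂ) :
    reduceTo A X = traceSnd (X.submatrix (glueEquiv K A) (glueEquiv K A)) := rfl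

/-- The `(e, e')` block of an operator on a composite system. -/
def block {S : Type*} (e e' : E) (Y : Matrix (S × E) (S × E) ℂ) : Matrix S S ℂ :=
  Matrix.of fun s s' => Y (s, e) (s', e')

theorem ext_block {S : Type*} {Y Z : Matrix (S × E) (S × E) ℂ}
    (h : ∀ e e', block e e' Y = block e e' Z) : Y = Z := by
  ext ⟨s, e⟩ ⟨s', e'⟩
  exact congrFun₂ (h e e') s s'

theorem block_kronecker_mul [Fintype E] {S : Type*} [Fintype S] (M : Matrix S S ℂ) (N : Matrix E E ℂ)
    (Y : Matrix (S × E) (S × E) ℂ) (e e' : E) :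
    block e e' ((M ⊗ₖ N) * Y) = ∑ f, N e f • (M * block f e' Y) := by
  ext s s'
  simp only [block, Matrix.of_apply, Matrix.mul_apply, Fintype.sum_prod_type, Matrix.sum_apply,
    Matrix.smul_apply, smul_eq_mul, Matrix.kroneckerMap_apply, Finset.mul_sum]
  rw [Finset.sum_comm]
  refine Finset.sum_congr rfl fun f _ => Finset.sum_congr rfl fun t _ => ?_
  ring

theorem block_kronecker_one_conj [Fintype E] [DecidableEq E] {S T : Type*} [Fintype S] [Fintype T] (M : Matrix T S ℂ)
    (Y : Matrix (S × E) (S × E) ℂ) (e e' : E) :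
    block e e' ((M ⊗ₖ (1 : Matrix E E ℂ)) * Y * (M ⊗ₖ (1 : Matrix E E ℂ))ᴴ) =
      M * block e e' Y * Mᴴ := by
  ext s s'
  simp [block, Matrix.mul_apply, Fintype.sum_prod_type, Matrix.one_apply, Finset.sum_mul,
    apply_ite (starRingEnd ℂ)]

theorem block_reduceToWith (A : Finset ι)
    (Y : Matrix ((ι → K) × E) ((ι → K) × E) ℂ) (e e' : E) :
    block e e' (reduceToWith A Y) = reduceTo A (block e e' Y) := rfl

theorem reduceTo_sum {κ : Type*} (s : Finset κ) (A : Finset ι)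
    (X : κ → Matrix (ι → K) (ι → K) ℂ) :
    reduceTo A (∑ k ∈ s, X k) = ∑ k ∈ s, reduceTo A (X k) := by
  ext x x'
  simp only [reduceTo, Matrix.of_apply, Matrix.sum_apply]
  rw [Finset.sum_comm]

theorem reduceTo_smul (c : ℂ) (A : Finset ι) (X : Matrix (ι → K) (ι → K) ℂ) :
    reduceTo A (c • X) = c • reduceTo A X := by
  ext x x'
  simp [reduceTo, Finset.mul_sum]

theorem reduceToWith_sum {κ : Type*} (s : Finset κ) (A : Finset ι)
    (Y : κ → Matrix ((ι → K) × E) ((ι → K) × E) ℂ) :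
    reduceToWith A (∑ k ∈ s, Y k) = ∑ k ∈ s, reduceToWith A (Y k) := by
  ext x x'
  simp only [reduceToWith, Matrix.of_apply, Matrix.sum_apply]
  rw [Finset.sum_comm]

theorem reduceToWith_smul (c : ℂ) (A : Finset ι) (Y : Matrix ((ι → K) × E) ((ι → K) × E) ℂ) :
    reduceToWith A (c • Y) = c • reduceToWith A Y := by
  ext x x'
  simp [reduceToWith, Finset.mul_sum]

theorem reduceToWith_posSemidef (A : Finset ι) {Y : Matrix ((ι → K) × E) ((ι → K) × E) ℂ}
    (hY : Y.PosSemidef) : (reduceToWith A Y).PosSemidef := by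
  have h : reduceToWith A Y = ∑ z : {i // i ∉ A} → K,
      Y.submatrix (fun x : (A → K) × E => (glue A x.1 z, x.2))
        (fun x => (glue A x.1 z, x.2)) := by
    ext x x'
    simp [reduceToWith, Matrix.sum_apply]
  rw [h]
  exact Matrix.posSemidef_sum _ fun z _ => hY.submatrix _

theorem trace_reduceToWith [Fintype E] (A : Finset ι) (Y : Matrix ((ι → K) × E) ((ι → K) × E) ℂ) :
    (reduceToWith A Y).trace = Y.trace := by
  simp only [Matrix.trace, Matrix.diag, reduceToWith, Matrix.of_apply, Fintype.sum_prod_type]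
  rw [← (glueEquiv K A).sum_comp, Fintype.sum_prod_type]
  refine Finset.sum_congr rfl fun x _ => ?_
  rw [Finset.sum_comm]
  rfl

end PartialTraceShares

/-! ### Weyl operators under partial trace -/

section Reduction

variable (p : ℕ) [Fact p.Prime] {K : Type*} [Field K] [Fintype K] [DecidableEq K]
  [Algebra (ZMod p) K] {ι E : Type*} [Fintype ι] [DecidableEq ι] [Fintype E] [DecidableEq E]

-- Extension by zero is adjoint to restriction, so a vector that separates on `A` is realized by a
-- Weyl operator acting on the shares of `A` alone.
omit [Fintype K] [DecidableEq K] in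
theorem symp_extend (A : Finset ι) (w : ι ⊕ ι → K) (v : A ⊕ A → K) :
    symp p w (extend A v) = symp p (restr A w) v := by
  have h : ∀ (x : ι → K) (y : A → K), ∑ i, x i * glue A y 0 i = ∑ i : A, x i * y i := fun x y => by
    rw [← Finset.sum_subset (Finset.subset_univ A) (fun i _ hi => by simp [glue, hi]),
      ← Finset.sum_coe_sort]
    exact Finset.sum_congr rfl fun i _ => by simp [glue]
  simp only [symp, extend, Sum.elim_inl, Sum.elim_inr, restr, Sum.map_inl, Sum.map_inr]
  simp_rw [mul_comm (glue A _ _ _), h, mul_comm (w (Sum.inr _))]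
  rfl

theorem weyl_submatrix_glueEquiv (A : Finset ι) (w : ι ⊕ ι → K) :
    (weyl p w).submatrix (glueEquiv K A) (glueEquiv K A) =
      weyl p (restr A w) ⊗ₖ weyl p (corestr A w) := by
  ext ⟨x, z⟩ ⟨y, t⟩
  simp only [Matrix.submatrix_apply, weyl, Matrix.of_apply, Matrix.kroneckerMap_apply,
    glueEquiv_apply]
  rw [← Fintype.prod_subtype_mul_prod_subtype (fun i => i ∈ A)]
  congr 1
  · refine Finset.prod_congr (by ext; simp) fun i _ => ?_
    simp [glue, restr]
  · refine Finset.prod_congr (by ext; simp) fun i _ => ?_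
    simp [glue, corestr, i.2]

/-- The Weyl operator is a tensor product over `A` and its complement, and the unitary on the
discarded factor cancels by cyclicity of the trace. -/
theorem reduceTo_weyl_conj (A : Finset ι) (w : ι ⊕ ι → K) (X : Matrix (ι → K) (ι → K) ℂ) :
    reduceTo A (weyl p w * X * (weyl p w)ᴴ) =
      weyl p (restr A w) * reduceTo A X * (weyl p (restr A w))ᴴ := by
  rw [reduceTo_eq_traceSnd, reduceTo_eq_traceSnd, ← Matrix.submatrix_mul_equiv _ _ _ (glueEquiv K A),
    ← Matrix.submatrix_mul_equiv _ _ _ (glueEquiv K A), ← Matrix.conjTranspose_submatrix,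
    weyl_submatrix_glueEquiv]
  set Y := X.submatrix (glueEquiv K A) (glueEquiv K A)
  set M := weyl p (restr A w)
  set N := weyl p (corestr A w) with hN
  have h : M ⊗ₖ N = (M ⊗ₖ 1) * ((1 : Matrix (A → K) (A → K) ℂ) ⊗ₖ N) := by
    rw [← Matrix.mul_kronecker_mul, mul_one, one_mul]
  have h' : (M ⊗ₖ N)ᴴ = ((1 : Matrix (A → K) (A → K) ℂ) ⊗ₖ N)ᴴ * (Mᴴ ⊗ₖ 1) := by
    rw [h, Matrix.conjTranspose_mul]
    simp [Matrix.conjTranspose_kronecker]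
  rw [h', ← mul_assoc, traceSnd_mul_kronecker_one, h, mul_assoc (M ⊗ₖ _), mul_assoc (M ⊗ₖ _),
    traceSnd_kronecker_one_mul, traceSnd_one_kronecker_conj]
  exact conjTranspose_weyl_mul_self p _

theorem reduceTo_weyl_extend_mul (A : Finset ι) (v : A ⊕ A → K) (X : Matrix (ι → K) (ι → K) ℂ) :
    reduceTo A (weyl p (extend A v) * X) = weyl p v * reduceTo A X := by
  rw [reduceTo_eq_traceSnd, reduceTo_eq_traceSnd, ← Matrix.submatrix_mul_equiv _ _ _ (glueEquiv K A),
    weyl_submatrix_glueEquiv, restr_extend, corestr_extend, weyl_zero, traceSnd_kronecker_one_mul]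

theorem reduceToWith_weyl_conj (A : Finset ι) (w : ι ⊕ ι → K)
    (Y : Matrix ((ι → K) × E) ((ι → K) × E) ℂ) :
    reduceToWith A ((weyl p w ⊗ₖ (1 : Matrix E E ℂ)) * Y * (weyl p w ⊗ₖ (1 : Matrix E E ℂ))ᴴ) =
      (weyl p (restr A w) ⊗ₖ (1 : Matrix E E ℂ)) * reduceToWith A Y *
        (weyl p (restr A w) ⊗ₖ (1 : Matrix E E ℂ))ᴴ := by
  refine ext_block fun e e' => ?_
  rw [block_reduceToWith, block_kronecker_one_conj, block_kronecker_one_conj, reduceTo_weyl_conj,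
    block_reduceToWith]

omit [DecidableEq E] in
theorem reduceToWith_weyl_extend_mul (A : Finset ι) (v : A ⊕ A → K) (N : Matrix E E ℂ)
    (Y : Matrix ((ι → K) × E) ((ι → K) × E) ℂ) :
    reduceToWith A ((weyl p (extend A v) ⊗ₖ N) * Y) = (weyl p v ⊗ₖ N) * reduceToWith A Y := by
  refine ext_block fun e e' => ?_
  rw [block_reduceToWith, block_kronecker_mul, block_kronecker_mul, reduceTo_sum]
  refine Finset.sum_congr rfl fun f _ => ?_
  rw [reduceTo_smul, reduceTo_weyl_extend_mul, block_reduceToWith]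

end Reduction

/-! ### Logical operators of a stabilizer code -/

section Logical

variable (p : ℕ) [Fact p.Prime] {K : Type*} [Field K] [Fintype K] [DecidableEq K]
  [Algebra (ZMod p) K] {ι κ : Type*} [Fintype ι] [DecidableEq ι] [Fintype κ] {ℓ : ℕ}
  {G : Matrix (ι ⊕ ι) κ K} {V : Matrix (ι → K) (Fin ℓ → K) ℂ}

variable {p}

/-- The code is invariant under the Weyl operators that commute with the stabilizer. -/
theorem IsStabilizerEncoding.weyl_mul (hV : IsStabilizerEncoding p G V) {w : ι ⊕ ι → K}
    (hw : ∀ y, symp p w (G *ᵥ y) = 0) : weyl p w * V = V * logicalWeyl p V w := by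
  obtain ⟨hiso, χ, hχ⟩ := hV
  refine Matrix.ext_of_mulVec_single fun x => ?_
  set e : (Fin ℓ → K) → ℂ := Pi.single x 1
  -- The range of `V` is the whole joint eigenspace, so it is enough to verify the eigenvalue
  -- equations.
  have hmem : weyl p w *ᵥ (V *ᵥ e) ∈ LinearMap.range V.mulVecLin := by
    rw [hχ]
    intro y
    have h1 := (hχ (V *ᵥ e)).mp ⟨e, rfl⟩ y
    rw [Matrix.mulVec_mulVec, weyl_mul_comm, hw, AddChar.map_zero_eq_one, one_smul,
      ← Matrix.mulVec_mulVec, h1, Matrix.mulVec_smul]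
  obtain ⟨φ, hφ⟩ := hmem
  rw [Matrix.mulVecLin_apply] at hφ
  rw [logicalWeyl, Matrix.mul_assoc, ← Matrix.mulVec_mulVec, ← Matrix.mulVec_mulVec, ← Matrix.mulVec_mulVec,
    ← Matrix.mulVec_mulVec, ← hφ, Matrix.mulVec_mulVec φ Vᴴ V, hiso, Matrix.one_mulVec]

theorem IsStabilizerEncoding.conjTranspose_logicalWeyl_mul_self
    (hV : IsStabilizerEncoding p G V) {w : ι ⊕ ι → K}
    (hw : ∀ y, symp p w (G *ᵥ y) = 0) : (logicalWeyl p V w)ᴴ * logicalWeyl p V w = 1 := by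
  have h : (logicalWeyl p V w)ᴴ * logicalWeyl p V w =
      (V * logicalWeyl p V w)ᴴ * (V * logicalWeyl p V w) := by
    rw [Matrix.conjTranspose_mul, Matrix.mul_assoc, ← Matrix.mul_assoc Vᴴ, hV.1, Matrix.one_mul]
  rw [h, ← hV.weyl_mul hw, Matrix.conjTranspose_mul, Matrix.mul_assoc, ← Matrix.mul_assoc _ _ V,
    conjTranspose_weyl_mul_self, Matrix.one_mul, hV.1]

/-- The stabilizer acts on the code by the scalar `χ y`, of modulus 1 by unitarity. Hence columns of
`G₁` are invisible in the encoded state. -/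
theorem IsStabilizerEncoding.weyl_stabilizer_conj (hV : IsStabilizerEncoding p G V) (y : κ → K)
    (X : Matrix (Fin ℓ → K) (Fin ℓ → K) ℂ) :
    weyl p (G *ᵥ y) * (V * X * Vᴴ) * (weyl p (G *ᵥ y))ᴴ = V * X * Vᴴ := by
  obtain ⟨hiso, χ, hχ⟩ := hV
  have h1 : weyl p (G *ᵥ y) * V = χ y • V := by
    refine Matrix.ext_of_mulVec_single fun x => ?_
    rw [← Matrix.mulVec_mulVec, Matrix.smul_mulVec]
    exact (hχ _).mp ⟨_, rfl⟩ y
  have h2 : star (χ y) * χ y = 1 := by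
    have h3 : (weyl p (G *ᵥ y) * V)ᴴ * (weyl p (G *ᵥ y) * V) = 1 := by
      rw [Matrix.conjTranspose_mul, Matrix.mul_assoc, ← Matrix.mul_assoc _ _ V,
        conjTranspose_weyl_mul_self, Matrix.one_mul, hiso]
    rw [h1, Matrix.conjTranspose_smul, Matrix.smul_mul, Matrix.mul_smul, hiso, smul_smul] at h3
    simpa using congrFun₂ h3 0 0
  have h4 : weyl p (G *ᵥ y) * (V * X * Vᴴ) * (weyl p (G *ᵥ y))ᴴ =
      (weyl p (G *ᵥ y) * V) * X * (weyl p (G *ᵥ y) * V)ᴴ := by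
    simp only [Matrix.conjTranspose_mul, Matrix.mul_assoc]
  rw [h4, h1, Matrix.conjTranspose_smul, Matrix.smul_mul, Matrix.smul_mul, Matrix.mul_smul,
    smul_smul, mul_comm, h2, one_smul]

/-- Logical Weyl operators of vectors outside of the stabilizer are traceless. -/
theorem IsStabilizerEncoding.trace_logicalWeyl (hV : IsStabilizerEncoding p G V) {w : ι ⊕ ι → K}
    (hw : ∀ y, symp p w (G *ᵥ y) = 0) (hw' : w ∉ LinearMap.range G.mulVecLin) :
    (logicalWeyl p V w).trace = 0 := by
  -- The vector `v` yields a logical unitary that commutes with that of `w` only up to a phase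
  -- different from 1; conjugation by it preserves the trace, which must therefore vanish.
  obtain ⟨v, hvw, hvN⟩ := exists_symp_ne_zero p hw'
  have hv : ∀ y, symp p v (G *ᵥ y) = 0 := fun y => by
    rw [symp_swap, neg_eq_zero]
    exact hvN _ ⟨y, rfl⟩
  have hcomm : logicalWeyl p V v * logicalWeyl p V w =
      ZMod.stdAddChar (symp p w v) • (logicalWeyl p V w * logicalWeyl p V v) := by
    have h : ∀ a b : ι ⊕ ι → K, (∀ y, symp p a (G *ᵥ y) = 0) → (∀ y, symp p b (G *ᵥ y) = 0) →
        logicalWeyl p V a * logicalWeyl p V b = Vᴴ * (weyl p a * weyl p b) * V := by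
      intro a b ha hb
      rw [logicalWeyl, Matrix.mul_assoc _ V, ← hV.weyl_mul hb]
      simp only [Matrix.mul_assoc]
    rw [h v w hv hw, h w v hw hv, weyl_mul_comm, Matrix.mul_smul, Matrix.smul_mul]
  have hu := mul_eq_one_comm.mp (hV.conjTranspose_logicalWeyl_mul_self hv)
  have h1 : (logicalWeyl p V w).trace =
      ZMod.stdAddChar (symp p w v) * (logicalWeyl p V w).trace := by
    conv_lhs => rw [← Matrix.mul_one (logicalWeyl p V w),
      ← hV.conjTranspose_logicalWeyl_mul_self hv, ← mul_assoc, Matrix.trace_mul_cycle, hcomm,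
      Matrix.smul_mul, mul_assoc, hu, mul_one, Matrix.trace_smul, smul_eq_mul]
  by_contra h0
  have h2 : ZMod.stdAddChar (symp p w v) = (1 : ℂ) := by
    apply mul_right_cancel₀ h0
    rw [one_mul, ← h1]
  rw [← AddChar.map_zero_eq_one (ZMod.stdAddChar (N := p)), ZMod.injective_stdAddChar.eq_iff] at h2
  exact hvw h2

end Logical

/-! ### Density matrices span all operators -/

section States

variable {S Y : Type*} [Fintype S] [DecidableEq S] [AddCommGroup Y] [Module ℂ Y]

/-- A linear map is determined by its values on states. -/
theorem linearMap_ext_of_isState {f g : Matrix S S ℂ →ₗ[ℂ] Y}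
    (h : ∀ ρ, IsState ρ → f ρ = g ρ) : f = g := by
  have hpos : ∀ M : Matrix S S ℂ, M.PosSemidef → f M = g M := by
    intro M hM
    by_cases h0 : M.trace = 0
    · rw [hM.trace_eq_zero_iff.mp h0, map_zero, map_zero]
    · have h1 : IsState (M.trace⁻¹ • M) := by
        refine ⟨hM.smul (inv_nonneg.mpr hM.trace_nonneg), ?_⟩
        rw [Matrix.trace_smul, smul_eq_mul, inv_mul_cancel₀ h0]
      have h2 := h _ h1
      rw [map_smul, map_smul] at h2
      exact smul_right_injective Y (inv_ne_zero h0) h2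
  have hvec : ∀ ψ : S → ℂ, f (Matrix.vecMulVec ψ (star ψ)) = g (Matrix.vecMulVec ψ (star ψ)) :=
    fun ψ => hpos _ (Matrix.posSemidef_vecMulVec_self_star ψ)
  have hsingle : ∀ x y : S, f (Matrix.single x y 1) = g (Matrix.single x y 1) := by
    intro x y
    set e : S → S → ℂ := fun x => Pi.single x 1 with he
    -- Polarization writes a matrix unit as a combination of rank-one positive matrices.
    have hpol : (2 : ℂ) • Matrix.single x y (1 : ℂ) =
        Matrix.vecMulVec (e x + e y) (star (e x + e y)) +
          Complex.I • Matrix.vecMulVec (e x + Complex.I • e y) (star (e x + Complex.I • e y)) -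
          (1 + Complex.I) • (Matrix.vecMulVec (e x) (star (e x)) +
            Matrix.vecMulVec (e y) (star (e y))) := by
      have hs : Matrix.single x y (1 : ℂ) = Matrix.vecMulVec (e x) (star (e y)) := by
        ext a b
        simp only [he, Matrix.single_apply, Matrix.vecMulVec_apply, Pi.single_apply, Pi.star_apply,
          eq_comm, ite_and, apply_ite star, star_one, star_zero, mul_ite, mul_one, mul_zero]
        split_ifs <;> rfl
      rw [hs]
      ext a b
      simp only [Matrix.smul_apply, Matrix.sub_apply, Matrix.add_apply, Matrix.vecMulVec_apply,
        Pi.star_apply, Pi.add_apply, Pi.smul_apply, smul_eq_mul, star_add, star_mul',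
        RCLike.star_def, Complex.conj_I]
      linear_combination (-(e y a) * (starRingEnd ℂ) (e x b) + e x a * (starRingEnd ℂ) (e y b) +
        Complex.I * (e y a) * (starRingEnd ℂ) (e y b)) * Complex.I_mul_I
    have h2 := congrArg f hpol
    have h3 := congrArg g hpol
    simp only [map_add, map_sub, map_smul, hvec] at h2 h3
    rw [← h3] at h2
    exact smul_right_injective Y (two_ne_zero (α := ℂ)) h2
  refine LinearMap.ext fun M => ?_
  rw [Matrix.matrix_eq_sum_single M]
  simp only [map_sum]
  refine Finset.sum_congr rfl fun x _ => Finset.sum_congr rfl fun y _ => ?_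
  have : Matrix.single x y (M x y) = M x y • Matrix.single x y (1 : ℂ) := by
    rw [Matrix.smul_single, smul_eq_mul, mul_one]
  rw [this, map_smul, map_smul, hsingle]

end States

/-! ### Channels followed by discarding shares -/

section ReducedChannels

variable {K ι L κ : Type*} [Fintype K] [Fintype ι] [DecidableEq ι] [Fintype L] [DecidableEq L]
  [Fintype κ]

/-- Kraus operators of a channel followed by the reduction to the shares in `A`. -/
def reducedKraus (A : Finset ι) (T : κ → Matrix (ι → K) L ℂ) :
    κ × ({i // i ∉ A} → K) → Matrix (A → K) L ℂ :=
  fun k => (T k.1).submatrix (fun x => glue A x k.2) id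

omit [DecidableEq L] in
theorem reduceTo_krausMap (A : Finset ι) (T : κ → Matrix (ι → K) L ℂ) (X : Matrix L L ℂ) :
    reduceTo A (krausMap T X) = krausMap (reducedKraus A T) X := by
  ext x x'
  simp only [reduceTo, krausMap_apply, Matrix.of_apply, Matrix.sum_apply, Fintype.sum_prod_type]
  rw [Finset.sum_comm]
  rfl

omit [Fintype L] in
theorem sum_reducedKraus (A : Finset ι) {T : κ → Matrix (ι → K) L ℂ}
    (hT : ∑ k, (T k)ᴴ * T k = 1) :
    ∑ k, (reducedKraus A T k)ᴴ * reducedKraus A T k = 1 := by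
  rw [← hT, Fintype.sum_prod_type]
  refine Finset.sum_congr rfl fun k _ => ?_
  ext a b
  simp only [Matrix.sum_apply, Matrix.mul_apply]
  rw [← (glueEquiv K A).sum_comp, Fintype.sum_prod_type, Finset.sum_comm]
  rfl

theorem reduceToWith_sum_kronecker (A : Finset ι) (T : κ → Matrix (ι → K) L ℂ)
    (Z : Matrix (L × L) (L × L) ℂ) :
    reduceToWith A (∑ k, (T k ⊗ₖ (1 : Matrix L L ℂ)) * Z * (T k ⊗ₖ (1 : Matrix L L ℂ))ᴴ) =
      ∑ k, (reducedKraus A T k ⊗ₖ (1 : Matrix L L ℂ)) * Z *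
        (reducedKraus A T k ⊗ₖ (1 : Matrix L L ℂ))ᴴ := by
  refine ext_block fun e e' => ?_
  rw [block_reduceToWith]
  have h1 : block e e' (∑ k, (T k ⊗ₖ (1 : Matrix L L ℂ)) * Z * (T k ⊗ₖ (1 : Matrix L L ℂ))ᴴ) =
      krausMap T (block e e' Z) := by
    rw [krausMap_apply]
    ext s s'
    simp only [block, Matrix.of_apply, Matrix.sum_apply]
    exact Finset.sum_congr rfl fun k _ =>
      congrFun₂ (block_kronecker_one_conj (T k) Z e e') s s'
  rw [h1, reduceTo_krausMap, krausMap_apply]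
  ext s s'
  simp only [block, Matrix.of_apply, Matrix.sum_apply]
  exact Finset.sum_congr rfl fun k _ =>
    (congrFun₂ (block_kronecker_one_conj (reducedKraus A T k) Z e e') s s').symm

end ReducedChannels

/-! ### Operators acting on entangled vectors -/

section EntangledVec

variable {L : Type*} [Fintype L]

/-- An operator on the reference half of a maximally entangled vector can be moved to the other half
as its transpose. -/
theorem kronecker_mulVec_entangledVec {S : Type*} [Fintype S] (M : Matrix S S ℂ)
    (N : Matrix L L ℂ) (U : Matrix S L ℂ) :
    (M ⊗ₖ N) *ᵥ entangledVec U = entangledVec (M * U * Nᵀ) := by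
  ext ⟨s, l⟩
  simp only [Matrix.mulVec, dotProduct, Fintype.sum_prod_type, Matrix.kroneckerMap_apply,
    entangledVec, Matrix.mul_apply, Matrix.transpose_apply, Finset.sum_mul, Finset.mul_sum]
  rw [Finset.sum_comm]
  refine Finset.sum_congr rfl fun t _ => Finset.sum_congr rfl fun l' _ => ?_
  ring

theorem block_vecMulVec_entangledVec [DecidableEq L] {S : Type*} (U : Matrix S L ℂ)
    (e e' : L) : block e e' (Matrix.vecMulVec (entangledVec U) (star (entangledVec U))) =
      (Fintype.card L : ℂ)⁻¹ • (U * Matrix.single e e' (1 : ℂ) * Uᴴ) := by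
  ext s s'
  simp only [block, Matrix.of_apply, Matrix.vecMulVec_apply, entangledVec, Pi.star_apply,
    star_mul', RCLike.star_def, conj_inv_sqrt_card, Matrix.smul_apply, smul_eq_mul,
    ← inv_sqrt_card_mul_self]
  have h : (U * Matrix.single e e' (1 : ℂ) * Uᴴ) s s' = U s e * (starRingEnd ℂ) (U s' e') := by
    simp [Matrix.mul_apply, Matrix.single_apply, ite_and]
  rw [h]
  ring

end EntangledVec

/-! ### Encoded states of the two quantum protocols -/

section Protocols

variable (p : ℕ) [Fact p.Prime] {K : Type*} [Field K] [Fintype K] [DecidableEq K]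
  [Algebra (ZMod p) K] {ι κ κ' μ : Type*} [Fintype ι] [DecidableEq ι] [Fintype κ] [Fintype κ']
  [DecidableEq κ] [Fintype μ] {ℓ : ℕ}

omit [Fintype ι] [DecidableEq ι] [Field K] [DecidableEq K] in
theorem codeEntangled_eq (V : Matrix (ι → K) (Fin ℓ → K) ℂ) :
    codeEntangled V = entangledVec V := rfl

/-- Kraus operators of the encoder of the linear QQSS protocol. -/
def encoderKraus (V : Matrix (ι → K) (Fin ℓ → K) ℂ) (G₂ : Matrix (ι ⊕ ι) κ K) (u : κ → K) :
    Matrix (ι → K) (Fin ℓ → K) ℂ :=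
  ((Real.sqrt (Fintype.card (κ → K)) : ℝ) : ℂ)⁻¹ • (weyl p (G₂ *ᵥ u) * V)

theorem qqssEncoder_eq_krausMap (V : Matrix (ι → K) (Fin ℓ → K) ℂ) (G₂ : Matrix (ι ⊕ ι) κ K)
    (X : Matrix (Fin ℓ → K) (Fin ℓ → K) ℂ) :
    qqssEncoder p V G₂ X = krausMap (encoderKraus p V G₂) X := by
  rw [qqssEncoder, krausMap_apply]
  refine Finset.sum_congr rfl fun u _ => ?_
  rw [encoderKraus, Matrix.conjTranspose_smul, RCLike.star_def, conj_inv_sqrt_card, Matrix.smul_mul,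
    Matrix.smul_mul, Matrix.mul_smul, smul_smul, inv_sqrt_card_mul_self]
  simp only [Matrix.conjTranspose_mul, Matrix.mul_assoc]

theorem sum_encoderKraus {V : Matrix (ι → K) (Fin ℓ → K) ℂ} (hV : Vᴴ * V = 1)
    (G₂ : Matrix (ι ⊕ ι) κ K) :
    ∑ u, (encoderKraus p V G₂ u)ᴴ * encoderKraus p V G₂ u = 1 := by
  have h : ∀ u, (encoderKraus p V G₂ u)ᴴ * encoderKraus p V G₂ u =
      (Fintype.card (κ → K) : ℂ)⁻¹ • 1 := fun u => by
    rw [encoderKraus, Matrix.conjTranspose_smul, RCLike.star_def, conj_inv_sqrt_card,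
      Matrix.smul_mul, Matrix.mul_smul, smul_smul, inv_sqrt_card_mul_self,
      Matrix.conjTranspose_mul, Matrix.mul_assoc, ← Matrix.mul_assoc _ _ V,
      conjTranspose_weyl_mul_self, Matrix.one_mul, hV]
  simp_rw [h]
  rw [Finset.sum_const, Finset.card_univ, ← Nat.cast_smul_eq_nsmul ℂ, smul_smul,
    mul_inv_cancel₀ (by simp), one_smul]

variable {p} {G₁ : Matrix (ι ⊕ ι) κ' K} {V : Matrix (ι → K) (Fin ℓ → K) ℂ}

theorem IsStabilizerEncoding.weyl_code_conj (hV : IsStabilizerEncoding p G₁ V) {w : ι ⊕ ι → K}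
    (hw : ∀ y, symp p w (G₁ *ᵥ y) = 0) (X : Matrix (Fin ℓ → K) (Fin ℓ → K) ℂ) :
    weyl p w * (V * X * Vᴴ) * (weyl p w)ᴴ =
      V * (logicalWeyl p V w * X * (logicalWeyl p V w)ᴴ) * Vᴴ := by
  have h : weyl p w * (V * X * Vᴴ) * (weyl p w)ᴴ = (weyl p w * V) * X * (weyl p w * V)ᴴ := by
    simp only [Matrix.conjTranspose_mul, Matrix.mul_assoc]
  rw [h, hV.weyl_mul hw]
  simp only [Matrix.conjTranspose_mul, Matrix.mul_assoc]

theorem IsStabilizerEncoding.qqssEncoder_conj (hV : IsStabilizerEncoding p G₁ V)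
    {w : ι ⊕ ι → K} (hw : ∀ y, symp p w (G₁ *ᵥ y) = 0) (G₂ : Matrix (ι ⊕ ι) κ K)
    (X : Matrix (Fin ℓ → K) (Fin ℓ → K) ℂ) :
    qqssEncoder p V G₂ (logicalWeyl p V w * X * (logicalWeyl p V w)ᴴ) =
      ∑ u : κ → K, (Fintype.card (κ → K) : ℂ)⁻¹ •
        (weyl p (w + G₂ *ᵥ u) * (V * X * Vᴴ) * (weyl p (w + G₂ *ᵥ u))ᴴ) := by
  rw [qqssEncoder]
  refine Finset.sum_congr rfl fun u _ => ?_
  rw [add_comm w, weyl_add_conj, hV.weyl_code_conj hw]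

/-- This links the two protocols: the EASS state is the QQSS encoder applied to half of an entangled
pair modified by the logical `W(F m)`, so facts about the encoder transfer block by block. -/
theorem IsStabilizerEncoding.block_eassState (hV : IsStabilizerEncoding p G₁ V)
    {F : Matrix (ι ⊕ ι) μ K} {m : μ → K} (hw : ∀ y, symp p (F *ᵥ m) (G₁ *ᵥ y) = 0)
    (G₂ : Matrix (ι ⊕ ι) κ K) (e e' : Fin ℓ → K) :
    block e e' (eassState p V G₂ F m) = (Fintype.card (Fin ℓ → K) : ℂ)⁻¹ •
      qqssEncoder p V G₂ (logicalWeyl p V (F *ᵥ m) * Matrix.single e e' 1 *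
        (logicalWeyl p V (F *ᵥ m))ᴴ) := by
  have h : block e e' (eassState p V G₂ F m) = ∑ u : κ → K, (Fintype.card (κ → K) : ℂ)⁻¹ •
      block e e' ((weyl p (F *ᵥ m + G₂ *ᵥ u) ⊗ₖ (1 : Matrix (Fin ℓ → K) (Fin ℓ → K) ℂ)) *
        Matrix.vecMulVec (codeEntangled V) (star (codeEntangled V)) *
        (weyl p (F *ᵥ m + G₂ *ᵥ u) ⊗ₖ (1 : Matrix (Fin ℓ → K) (Fin ℓ → K) ℂ))ᴴ) := by
    ext s s'
    simp only [eassState, block, Matrix.of_apply, Matrix.sum_apply, Matrix.smul_apply]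
  rw [h, hV.qqssEncoder_conj hw, Finset.smul_sum]
  refine Finset.sum_congr rfl fun u _ => ?_
  rw [block_kronecker_one_conj, codeEntangled_eq, block_vecMulVec_entangledVec, Matrix.mul_smul,
    Matrix.smul_mul, smul_comm]

theorem IsStabilizerEncoding.eassState_eq (hV : IsStabilizerEncoding p G₁ V)
    {F : Matrix (ι ⊕ ι) μ K} {m : μ → K} (hw : ∀ y, symp p (F *ᵥ m) (G₁ *ᵥ y) = 0)
    (G₂ : Matrix (ι ⊕ ι) κ K) :
    eassState p V G₂ F m =
      ∑ u, (encoderKraus p V G₂ u ⊗ₖ (1 : Matrix (Fin ℓ → K) (Fin ℓ → K) ℂ)) *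
        Matrix.vecMulVec (entangledVec (logicalWeyl p V (F *ᵥ m)))
          (star (entangledVec (logicalWeyl p V (F *ᵥ m)))) *
        (encoderKraus p V G₂ u ⊗ₖ (1 : Matrix (Fin ℓ → K) (Fin ℓ → K) ℂ))ᴴ := by
  refine ext_block fun e e' => ?_
  rw [hV.block_eassState hw, qqssEncoder_eq_krausMap, ← map_smul, ← block_vecMulVec_entangledVec,
    krausMap_apply]
  ext s s'
  simp only [block, Matrix.of_apply, Matrix.sum_apply]
  exact Finset.sum_congr rfl fun u _ => (congrFun₂ (block_kronecker_one_conj _ _ e e') s s').symm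

theorem IsStabilizerEncoding.eassState_posSemidef (hV : IsStabilizerEncoding p G₁ V)
    {F : Matrix (ι ⊕ ι) μ K} {m : μ → K} (hw : ∀ y, symp p (F *ᵥ m) (G₁ *ᵥ y) = 0)
    (G₂ : Matrix (ι ⊕ ι) κ K) : (eassState p V G₂ F m).PosSemidef := by
  rw [hV.eassState_eq hw]
  exact Matrix.posSemidef_sum _ fun u _ =>
    (Matrix.posSemidef_vecMulVec_self_star _).mul_mul_conjTranspose_same _

theorem IsStabilizerEncoding.trace_eassState (hV : IsStabilizerEncoding p G₁ V)
    {F : Matrix (ι ⊕ ι) μ K} {m : μ → K} (hw : ∀ y, symp p (F *ᵥ m) (G₁ *ᵥ y) = 0)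
    (G₂ : Matrix (ι ⊕ ι) κ K) : (eassState p V G₂ F m).trace = 1 := by
  have h1 : (eassState p V G₂ F m).trace =
      ∑ e, (block e e (eassState p V G₂ F m)).trace := by
    simp only [Matrix.trace, Matrix.diag, Fintype.sum_prod_type, block, Matrix.of_apply]
    rw [Finset.sum_comm]
  have h2 : ∀ e, (block e e (eassState p V G₂ F m)).trace =
      (Fintype.card (Fin ℓ → K) : ℂ)⁻¹ := fun e => by
    rw [hV.block_eassState hw, qqssEncoder_eq_krausMap, Matrix.trace_smul,
      trace_krausMap (sum_encoderKraus p hV.1 G₂), Matrix.trace_mul_comm, ← Matrix.mul_assoc,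
      hV.conjTranspose_logicalWeyl_mul_self hw, Matrix.one_mul, Matrix.trace_single_eq_same,
      smul_eq_mul, mul_one]
  rw [h1, Finset.sum_congr rfl fun e _ => h2 e, Finset.sum_const, Finset.card_univ, nsmul_eq_mul,
    mul_inv_cancel₀ (by simp)]

/-- Logical Weyl operators that agree on `A` up to columns of `G` cannot be told apart on `A`. -/
theorem IsStabilizerEncoding.reduceTo_qqssEncoder_conj (hV : IsStabilizerEncoding p G₁ V)
    {w w' : ι ⊕ ι → K} (hw : ∀ y, symp p w (G₁ *ᵥ y) = 0) (hw' : ∀ y, symp p w' (G₁ *ᵥ y) = 0)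
    (G₂ : Matrix (ι ⊕ ι) κ K) {A : Finset ι} {y : κ' → K} {u : κ → K}
    (h : restr A (w - w') = restr A (G₁ *ᵥ y + G₂ *ᵥ u)) (X : Matrix (Fin ℓ → K) (Fin ℓ → K) ℂ) :
    reduceTo A (qqssEncoder p V G₂ (logicalWeyl p V w * X * (logicalWeyl p V w)ᴴ)) =
      reduceTo A (qqssEncoder p V G₂ (logicalWeyl p V w' * X * (logicalWeyl p V w')ᴴ)) := by
  -- The difference of `w` and `w'` on `A` splits into a shift of the randomness by `u` and a
  -- stabilizer element, which acts trivially.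
  have hr : ∀ t, restr A (w + G₂ *ᵥ t) = restr A (w' + G₂ *ᵥ (t + u) + G₁ *ᵥ y) := fun t => by
    have h1 : w + G₂ *ᵥ t = (w - w') + (w' + G₂ *ᵥ t) := by abel
    have h2 : w' + G₂ *ᵥ (t + u) + G₁ *ᵥ y = (G₁ *ᵥ y + G₂ *ᵥ u) + (w' + G₂ *ᵥ t) := by
      rw [Matrix.mulVec_add]; abel
    rw [h1, h2, restr_add, h, ← restr_add]
  have hterm : ∀ t, reduceTo A (weyl p (w + G₂ *ᵥ t) * (V * X * Vᴴ) * (weyl p (w + G₂ *ᵥ t))ᴴ) =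
      reduceTo A (weyl p (w' + G₂ *ᵥ (t + u)) * (V * X * Vᴴ) *
        (weyl p (w' + G₂ *ᵥ (t + u)))ᴴ) := fun t => by
    rw [reduceTo_weyl_conj, hr, ← reduceTo_weyl_conj, weyl_add_conj, hV.weyl_stabilizer_conj]
  rw [hV.qqssEncoder_conj hw, hV.qqssEncoder_conj hw', reduceTo_sum, reduceTo_sum]
  simp_rw [reduceTo_smul, hterm]
  exact Equiv.sum_comp (Equiv.addRight u) fun t => (Fintype.card (κ → K) : ℂ)⁻¹ •
    reduceTo A (weyl p (w' + G₂ *ᵥ t) * (V * X * Vᴴ) * (weyl p (w' + G₂ *ᵥ t))ᴴ)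

/-- The images of the reduced preshared state under two Weyl operators that differ on `A` by a
vector outside of the span of `G₁` are orthogonal. -/
theorem IsStabilizerEncoding.weyl_conj_orthogonal (hV : IsStabilizerEncoding p G₁ V) {A : Finset ι}
    {a b : A ⊕ A → K} (hab : ∀ y, restr A (G₁ *ᵥ y) ≠ a - b)
    {Φ : Matrix ((A → K) × (Fin ℓ → K)) ((A → K) × (Fin ℓ → K)) ℂ}
    (hΦ : Φ = reduceToWith A (Matrix.vecMulVec (codeEntangled V) (star (codeEntangled V)))) :
    ((weyl p a ⊗ₖ (1 : Matrix (Fin ℓ → K) (Fin ℓ → K) ℂ)) * Φ *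
        (weyl p a ⊗ₖ (1 : Matrix (Fin ℓ → K) (Fin ℓ → K) ℂ))ᴴ) *
      ((weyl p b ⊗ₖ (1 : Matrix (Fin ℓ → K) (Fin ℓ → K) ℂ)) * Φ *
        (weyl p b ⊗ₖ (1 : Matrix (Fin ℓ → K) (Fin ℓ → K) ℂ))ᴴ) = 0 := by
  set N : Submodule K (A ⊕ A → K) := (LinearMap.range G₁.mulVecLin).map
    (LinearMap.funLeft K K (Sum.map Subtype.val Subtype.val)) with hN
  have hmem : a - b ∉ N := by
    rintro ⟨_, ⟨y, rfl⟩, hy⟩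
    exact hab y hy
  obtain ⟨v, hv, hvN⟩ := exists_symp_ne_zero p hmem
  have hvG : ∀ y, symp p (extend A v) (G₁ *ᵥ y) = 0 := fun y => by
    rw [symp_swap, symp_extend, neg_eq_zero]
    exact hvN _ ⟨_, ⟨y, rfl⟩, rfl⟩
  set U := logicalWeyl p V (extend A v) with hU
  have hUU : Uᴴ * U = 1 := hV.conjTranspose_logicalWeyl_mul_self hvG
  have hUU' : U * Uᴴ = 1 := mul_eq_one_comm.mp hUU
  -- The second factor is the complex conjugate of `U`; acting on the end-user's half it cancels the
  -- logical action of `W(v)`, so `S` fixes `Φ`.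
  set S : Matrix ((A → K) × (Fin ℓ → K)) ((A → K) × (Fin ℓ → K)) ℂ := weyl p v ⊗ₖ (Uᴴ)ᵀ with hS
  have hSΦ : S * Φ = Φ := by
    rw [hΦ, hS, ← reduceToWith_weyl_extend_mul, Matrix.mul_vecMulVec, codeEntangled_eq,
      kronecker_mulVec_entangledVec, Matrix.transpose_transpose, hV.weyl_mul hvG, Matrix.mul_assoc,
      ← hU, hUU', Matrix.mul_one]
  have hSS : Sᴴ * S = 1 := by
    have h : (Uᴴᵀ)ᴴ = Uᵀ := by ext; simp
    rw [hS, Matrix.conjTranspose_kronecker, ← Matrix.mul_kronecker_mul, conjTranspose_weyl_mul_self,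
      h, ← Matrix.transpose_mul, hUU, Matrix.transpose_one, Matrix.one_kronecker_one]
  have hΦh : Φᴴ = Φ := by
    rw [hΦ]
    exact (reduceToWith_posSemidef A (Matrix.posSemidef_vecMulVec_self_star _)).isHermitian
  set R : (A ⊕ A → K) → Matrix ((A → K) × (Fin ℓ → K)) ((A → K) × (Fin ℓ → K)) ℂ := fun w =>
    (weyl p w ⊗ₖ (1 : Matrix (Fin ℓ → K) (Fin ℓ → K) ℂ)) * Φ *
      (weyl p w ⊗ₖ (1 : Matrix (Fin ℓ → K) (Fin ℓ → K) ℂ))ᴴ with hR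
  have hRh : ∀ w, (R w)ᴴ = R w := fun w => by
    simp only [hR, Matrix.conjTranspose_mul, Matrix.conjTranspose_conjTranspose, hΦh,
      Matrix.mul_assoc]
  have hSR : ∀ w, S * R w = ZMod.stdAddChar (symp p w v) • R w := fun w => by
    have h1 : S * (weyl p w ⊗ₖ (1 : Matrix (Fin ℓ → K) (Fin ℓ → K) ℂ)) =
        ZMod.stdAddChar (symp p w v) • ((weyl p w ⊗ₖ 1) * S) := by
      rw [hS, ← Matrix.mul_kronecker_mul, ← Matrix.mul_kronecker_mul, weyl_mul_comm,
        Matrix.smul_kronecker, Matrix.one_mul, Matrix.mul_one]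
    simp only [hR]
    rw [← Matrix.mul_assoc, ← Matrix.mul_assoc, h1, Matrix.smul_mul, Matrix.mul_assoc _ S Φ, hSΦ,
      Matrix.smul_mul]
  change R a * R b = 0
  clear_value R
  -- Both factors lie in eigenspaces of the unitary `S`, with eigenvalues that differ because `symp
  -- p (a - b) v ≠ 0`.
  have h1 : R a * R b =
      (star (ZMod.stdAddChar (symp p a v)) * ZMod.stdAddChar (symp p b v) : ℂ) • (R a * R b) := by
    have h2 : R a * R b = (S * R a)ᴴ * (S * R b) := by
      rw [Matrix.conjTranspose_mul, Matrix.mul_assoc (R a)ᴴ, ← Matrix.mul_assoc Sᴴ, hSS,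
        Matrix.one_mul, hRh]
    conv_lhs => rw [h2, hSR, hSR, Matrix.conjTranspose_smul, Matrix.smul_mul, Matrix.mul_smul, hRh,
      smul_smul]
  by_contra h0
  have h2 : (star (ZMod.stdAddChar (symp p a v)) * ZMod.stdAddChar (symp p b v) : ℂ) = 1 := by
    by_contra h3
    apply h0
    have h4 : (1 - (star (ZMod.stdAddChar (symp p a v)) * ZMod.stdAddChar (symp p b v) : ℂ)) •
        (R a * R b) = 0 := by
      rw [sub_smul, one_smul, ← h1, sub_self]
    exact (smul_eq_zero.mp h4).resolve_left (sub_ne_zero.mpr (Ne.symm h3))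
  have h3 : (ZMod.stdAddChar (symp p a v) : ℂ) = ZMod.stdAddChar (symp p b v) := by
    have h4 : (ZMod.stdAddChar (symp p a v) : ℂ) * star (ZMod.stdAddChar (symp p a v) : ℂ) = 1 := by
      rw [RCLike.star_def, mul_comm, ← Complex.normSq_eq_conj_mul_self, Complex.normSq_eq_norm_sq]
      simp
    rw [← mul_one (ZMod.stdAddChar (symp p a v) : ℂ), ← h2, ← mul_assoc, h4, one_mul]
  rw [ZMod.injective_stdAddChar.eq_iff] at h3
  exact hv (by rw [symp_sub_left, h3, sub_self])

/-- Both states are mixtures over the `G₂` randomness, and the hypothesis keeps every pair of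
components apart modulo the span of `G₁` on `A`. -/
theorem IsStabilizerEncoding.eassState_orthogonal (hV : IsStabilizerEncoding p G₁ V)
    (F : Matrix (ι ⊕ ι) μ K) (G₂ : Matrix (ι ⊕ ι) κ K) {A : Finset ι} {m m' : μ → K}
    (h : ∀ y u, restr A (F *ᵥ (m - m')) ≠ restr A (G₁ *ᵥ y + G₂ *ᵥ u)) :
    reduceToWith A (eassState p V G₂ F m) * reduceToWith A (eassState p V G₂ F m') = 0 := by
  simp only [eassState, reduceToWith_sum, reduceToWith_smul, reduceToWith_weyl_conj]
  rw [Matrix.sum_mul]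
  refine Finset.sum_eq_zero fun u _ => ?_
  rw [Matrix.mul_sum]
  refine Finset.sum_eq_zero fun u' _ => ?_
  rw [Matrix.smul_mul, Matrix.mul_smul, hV.weyl_conj_orthogonal _ rfl, smul_zero, smul_zero]
  intro y hy
  refine h y (u' - u) ?_
  have h1 : F *ᵥ (m - m') = (F *ᵥ m + G₂ *ᵥ u) - (F *ᵥ m' + G₂ *ᵥ u') + G₂ *ᵥ (u' - u) := by
    rw [Matrix.mulVec_sub, Matrix.mulVec_sub]; abel
  rw [h1, restr_add, restr_add, hy]
  rfl

end Protocols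

/-! ### Decodability and secrecy -/

section Security

variable {p : ℕ} [Fact p.Prime] {K : Type*} [Field K] [Fintype K] [DecidableEq K]
  [Algebra (ZMod p) K] {ι κ κ' μ : Type*} [Fintype ι] [DecidableEq ι] [Fintype κ] [Fintype κ']
  [DecidableEq κ] [Fintype μ] {ℓ : ℕ}
  {G₁ : Matrix (ι ⊕ ι) κ' K} {F : Matrix (ι ⊕ ι) μ K} {V : Matrix (ι → K) (Fin ℓ → K) ℂ}

-- Up to a scalar the product is the logical operator of `F (m' - m)`, which lies outside the
-- stabilizer and is therefore traceless.
omit [DecidableEq κ] [Fintype κ] in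
theorem IsStabilizerEncoding.trace_conjTranspose_logicalWeyl_mul
    (hV : IsStabilizerEncoding p G₁ V) (hF : ColumnOrthogonal p F G₁)
    (hind : ∀ m, F *ᵥ m ∈ LinearMap.range G₁.mulVecLin → m = 0) {m m' : μ → K} (hm : m ≠ m') :
    ((logicalWeyl p V (F *ᵥ m))ᴴ * logicalWeyl p V (F *ᵥ m')).trace = 0 := by
  obtain ⟨c, hc⟩ := exists_conjTranspose_weyl_mul p (F *ᵥ m) (F *ᵥ m')
  have h : (logicalWeyl p V (F *ᵥ m))ᴴ * logicalWeyl p V (F *ᵥ m') =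
      Vᴴ * ((weyl p (F *ᵥ m))ᴴ * weyl p (F *ᵥ m')) * V := by
    have h1 : (logicalWeyl p V (F *ᵥ m))ᴴ = Vᴴ * (weyl p (F *ᵥ m))ᴴ * V := by
      simp only [logicalWeyl, Matrix.conjTranspose_mul, Matrix.conjTranspose_conjTranspose,
        Matrix.mul_assoc]
    rw [h1, Matrix.mul_assoc _ V, ← hV.weyl_mul (hF m')]
    simp only [Matrix.mul_assoc]
  have h2 : (logicalWeyl p V (F *ᵥ (m' - m))).trace = 0 :=
    hV.trace_logicalWeyl (hF _) fun hmem => hm (sub_eq_zero.mp (hind _ hmem)).symm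
  rw [h, hc, ← Matrix.mulVec_sub, Matrix.mul_smul, Matrix.smul_mul, Matrix.trace_smul]
  change c • (logicalWeyl p V (F *ᵥ (m' - m))).trace = 0
  rw [h2, smul_zero]

/-- If the QQSS protocol is decodable from `A`, then `A` is accepted. -/
theorem IsStabilizerEncoding.eq_zero_of_qqssDecodes (hV : IsStabilizerEncoding p G₁ V)
    (hF : ColumnOrthogonal p F G₁) (hind : ∀ m, F *ᵥ m ∈ LinearMap.range G₁.mulVecLin → m = 0)
    {G₂ : Matrix (ι ⊕ ι) κ K} {A : Finset ι}
    {D : Matrix (A → K) (A → K) ℂ → Matrix (Fin ℓ → K) (Fin ℓ → K) ℂ}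
    (hD : QQSSDecodes (qqssEncoder p V G₂) A D) {m : μ → K} {y : κ' → K} {u : κ → K}
    (h : restr A (F *ᵥ m) = restr A (G₁ *ᵥ y + G₂ *ᵥ u)) : m = 0 := by
  obtain ⟨⟨L, hLD, -, -⟩, hdec⟩ := hD
  -- Recovery of states extends by linearity to all operators.
  have hid : L ∘ₗ krausMap (reducedKraus A (encoderKraus p V G₂)) = LinearMap.id := by
    refine linearMap_ext_of_isState fun ρ hρ => ?_
    rw [LinearMap.comp_apply, ← reduceTo_krausMap, ← qqssEncoder_eq_krausMap, hLD, hdec ρ hρ,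
      LinearMap.id_apply]
  have hid' : ∀ X, L (reduceTo A (qqssEncoder p V G₂ X)) = X := fun X => by
    rw [qqssEncoder_eq_krausMap, reduceTo_krausMap]
    exact LinearMap.congr_fun hid X
  have hU0 : ∀ m, (logicalWeyl p V (F *ᵥ m))ᴴ * logicalWeyl p V (F *ᵥ m) = 1 := fun m =>
    hV.conjTranspose_logicalWeyl_mul_self (hF m)
  by_contra hm
  set U := logicalWeyl p V (F *ᵥ m) with hU
  set U' := logicalWeyl p V (F *ᵥ (0 : μ → K)) with hU'
  -- The two conjugated messages give `A` the same reduced operator, so the decoder identifies them;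
  -- then `U'ᴴ U` is central, hence scalar, and tracelessness contradicts unitarity.
  have hconj : ∀ X, U * X * Uᴴ = U' * X * U'ᴴ := fun X => by
    rw [← hid' (U * X * Uᴴ), ← hid' (U' * X * U'ᴴ), hV.reduceTo_qqssEncoder_conj (hF m) (hF 0) G₂
      (by rwa [Matrix.mulVec_zero, sub_zero])]
  have hcomm : ∀ X, U'ᴴ * U * X = X * (U'ᴴ * U) := fun X => by
    calc U'ᴴ * U * X = U'ᴴ * (U * X * Uᴴ) * U := by
          rw [Matrix.mul_assoc U'ᴴ (U * X * Uᴴ), Matrix.mul_assoc (U * X), hU0, Matrix.mul_one,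
            Matrix.mul_assoc]
      _ = (U'ᴴ * U') * X * (U'ᴴ * U) := by
          rw [hconj]
          simp only [Matrix.mul_assoc]
      _ = _ := by rw [hU0, Matrix.one_mul]
  set T := U'ᴴ * U with hT
  have htr : T.trace = 0 := hV.trace_conjTranspose_logicalWeyl_mul hF hind (Ne.symm hm)
  have hTT : Tᴴ * T = 1 := by
    rw [hT, Matrix.conjTranspose_mul, Matrix.conjTranspose_conjTranspose, Matrix.mul_assoc,
      ← Matrix.mul_assoc U', mul_eq_one_comm.mp (hU0 0), Matrix.one_mul, hU0]
  obtain ⟨c, hc⟩ := Matrix.mem_range_scalar_of_commute_single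
    (M := T) fun i j _ => (hcomm (Matrix.single i j 1)).symm
  have hc0 : c = 0 := by
    rw [← hc, Matrix.scalar_apply, Matrix.trace_diagonal, Finset.sum_const, nsmul_eq_mul,
      mul_eq_zero] at htr
    exact htr.resolve_left (by simp)
  rw [← hc, hc0, map_zero, Matrix.mul_zero] at hTT
  exact zero_ne_one hTT

/-- If `A` is accepted, then the EASS protocol is decodable from `A`. -/
theorem IsStabilizerEncoding.exists_eassDecodes [DecidableEq μ] (hV : IsStabilizerEncoding p G₁ V)
    (hF : ColumnOrthogonal p F G₁) {G₂ : Matrix (ι ⊕ ι) κ K} {A : Finset ι}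
    (hA : ∀ m y u, restr A (F *ᵥ m) = restr A (G₁ *ᵥ y + G₂ *ᵥ u) → m = 0) :
    ∃ P, EASSDecodes (eassState p V G₂ F) A P := by
  obtain ⟨P, hP, hdet⟩ := exists_isPOVM_of_orthogonal
    (ρ := fun m => reduceToWith A (eassState p V G₂ F m))
    (fun m => reduceToWith_posSemidef A (hV.eassState_posSemidef (hF m) G₂))
    (fun m m' hm => hV.eassState_orthogonal F G₂ fun y u h =>
      hm (sub_eq_zero.mp (hA _ y u h)))
  exact ⟨P, hP, fun m => by rw [hdet, trace_reduceToWith, hV.trace_eassState (hF m)]⟩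

/-- If the reduced states of the EASS protocol on `B` do not depend on the message, then `B` is
rejected. -/
theorem IsStabilizerEncoding.exists_of_eassState_eq (hV : IsStabilizerEncoding p G₁ V)
    (hF : ColumnOrthogonal p F G₁) {G₂ : Matrix (ι ⊕ ι) κ K} {B : Finset ι}
    (hB : ∀ m m', reduceToWith B (eassState p V G₂ F m) = reduceToWith B (eassState p V G₂ F m'))
    (m : μ → K) : ∃ y u, restr B (F *ᵥ m) = restr B (G₁ *ᵥ y + G₂ *ᵥ u) := by
  by_contra! h
  -- Without such `y` and `u`, the common reduced state would be orthogonal to itself, hence zero,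
  -- against trace 1.
  have h1 := hV.eassState_orthogonal F G₂ (A := B) (m := m) (m' := 0) (by simpa using h)
  set R := reduceToWith B (eassState p V G₂ F 0) with hR
  have hRh : Rᴴ = R :=
    (reduceToWith_posSemidef B (hV.eassState_posSemidef (hF 0) G₂)).isHermitian
  rw [hB m 0, ← hR] at h1
  have h2 : Rᴴ * R = 0 := by rw [hRh, h1]
  rw [Matrix.conjTranspose_mul_self_eq_zero] at h2
  have h3 := trace_reduceToWith B (eassState p V G₂ F 0)
  rw [hV.trace_eassState (hF 0), ← hR, h2, Matrix.trace_zero] at h3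
  exact zero_ne_one h3

/-- If `B` is rejected, then the reduced states of the EASS protocol on `B` do not depend on the
message. -/
theorem IsStabilizerEncoding.eassState_eq_of_exists (hV : IsStabilizerEncoding p G₁ V)
    (hF : ColumnOrthogonal p F G₁) {G₂ : Matrix (ι ⊕ ι) κ K} {B : Finset ι}
    (hB : ∀ m, ∃ y u, restr B (F *ᵥ m) = restr B (G₁ *ᵥ y + G₂ *ᵥ u)) (m m' : μ → K) :
    reduceToWith B (eassState p V G₂ F m) = reduceToWith B (eassState p V G₂ F m') := by
  obtain ⟨y, u, h⟩ := hB (m - m')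
  rw [Matrix.mulVec_sub] at h
  refine ext_block fun e e' => ?_
  rw [block_reduceToWith, block_reduceToWith, hV.block_eassState (hF m),
    hV.block_eassState (hF m'), reduceTo_smul, reduceTo_smul,
    hV.reduceTo_qqssEncoder_conj (hF m) (hF m') G₂ h]

/-- If the reduced state of the QQSS protocol on `B` does not depend on the message, then neither
does that of the EASS protocol. -/
theorem IsStabilizerEncoding.eassState_eq_of_qqss (hV : IsStabilizerEncoding p G₁ V)
    (hF : ColumnOrthogonal p F G₁) {G₂ : Matrix (ι ⊕ ι) κ K} {B : Finset ι}
    (hB : ∀ ρ σ, IsState ρ → IsState σ →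
      reduceTo B (qqssEncoder p V G₂ ρ) = reduceTo B (qqssEncoder p V G₂ σ)) (m m' : μ → K) :
    reduceToWith B (eassState p V G₂ F m) = reduceToWith B (eassState p V G₂ F m') := by
  have hσ : IsState (Matrix.single (0 : Fin ℓ → K) (0 : Fin ℓ → K) (1 : ℂ)) := by
    refine ⟨?_, Matrix.trace_single_eq_same _ _⟩
    have := Matrix.posSemidef_conjTranspose_mul_self
      (Matrix.single (0 : Fin ℓ → K) (0 : Fin ℓ → K) (1 : ℂ))
    simpa using this
  set σ := Matrix.single (0 : Fin ℓ → K) (0 : Fin ℓ → K) (1 : ℂ)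
  -- A linear map that is constant on states is the trace times that constant; the blocks of the
  -- EASS state have traces independent of `m`.
  have hlin : krausMap (reducedKraus B (encoderKraus p V G₂)) =
      (Matrix.traceLinearMap (Fin ℓ → K) ℂ ℂ).smulRight
        (reduceTo B (qqssEncoder p V G₂ σ)) := by
    refine linearMap_ext_of_isState fun ρ hρ => ?_
    rw [← reduceTo_krausMap, ← qqssEncoder_eq_krausMap, hB ρ σ hρ hσ, LinearMap.smulRight_apply,
      Matrix.traceLinearMap_apply, hρ.2, one_smul]
  have hval : ∀ X, reduceTo B (qqssEncoder p V G₂ X) =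
      X.trace • reduceTo B (qqssEncoder p V G₂ σ) := fun X => by
    rw [qqssEncoder_eq_krausMap, reduceTo_krausMap]
    exact LinearMap.congr_fun hlin X
  have htr : ∀ m (X : Matrix (Fin ℓ → K) (Fin ℓ → K) ℂ),
      (logicalWeyl p V (F *ᵥ m) * X * (logicalWeyl p V (F *ᵥ m))ᴴ).trace = X.trace :=
    fun m X => by
      rw [Matrix.trace_mul_comm, ← Matrix.mul_assoc,
        hV.conjTranspose_logicalWeyl_mul_self (hF m), Matrix.one_mul]
  refine ext_block fun e e' => ?_
  rw [block_reduceToWith, block_reduceToWith, hV.block_eassState (hF m),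
    hV.block_eassState (hF m'), reduceTo_smul, reduceTo_smul, hval, hval (_ * _ * _), htr, htr]

variable [DecidableEq μ] (hcard : Fintype.card (μ → K) = Fintype.card ((Fin ℓ → K) × (Fin ℓ → K)))

include hcard in
/-- If `B` is rejected, then the reduced state of the QQSS protocol on `B` does not depend on the
message. -/
theorem IsStabilizerEncoding.qqssEncoder_eq_of_exists (hV : IsStabilizerEncoding p G₁ V)
    (hF : ColumnOrthogonal p F G₁) (hind : ∀ m, F *ᵥ m ∈ LinearMap.range G₁.mulVecLin → m = 0)
    {G₂ : Matrix (ι ⊕ ι) κ K} {B : Finset ι}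
    (hB : ∀ m, ∃ y u, restr B (F *ᵥ m) = restr B (G₁ *ᵥ y + G₂ *ᵥ u))
    {ρ σ : Matrix (Fin ℓ → K) (Fin ℓ → K) ℂ} (hρ : IsState ρ) (hσ : IsState σ) :
    reduceTo B (qqssEncoder p V G₂ ρ) = reduceTo B (qqssEncoder p V G₂ σ) := by
  set U : (μ → K) → Matrix (Fin ℓ → K) (Fin ℓ → K) ℂ := fun m => logicalWeyl p V (F *ᵥ m) with hU
  have hU1 : ∀ m, (U m)ᴴ * U m = 1 := fun m => hV.conjTranspose_logicalWeyl_mul_self (hF m)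
  have hU0 : ∀ m m', m ≠ m' → ((U m)ᴴ * U m').trace = 0 := fun m m' h =>
    hV.trace_conjTranspose_logicalWeyl_mul hF hind h
  have hzero : U 0 = 1 := by
    simp only [hU, Matrix.mulVec_zero, logicalWeyl, weyl_zero, Matrix.mul_one, hV.1]
  have hconst : ∀ X m, reduceTo B (qqssEncoder p V G₂ (U m * X * (U m)ᴴ)) =
      reduceTo B (qqssEncoder p V G₂ X) := fun X m => by
    obtain ⟨y, u, h⟩ := hB m
    have h0 : reduceTo B (qqssEncoder p V G₂ (U m * X * (U m)ᴴ)) =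
        reduceTo B (qqssEncoder p V G₂ (U 0 * X * (U 0)ᴴ)) :=
      hV.reduceTo_qqssEncoder_conj (hF m) (hF 0) G₂ (by rwa [Matrix.mulVec_zero, sub_zero]) X
    rw [h0, hzero, Matrix.conjTranspose_one, Matrix.one_mul, Matrix.mul_one]
  -- The reduced output is constant along conjugates by the `U m`, whose sum is a multiple of the
  -- identity depending only on the trace of `X`.
  have havg : ∀ X, (Fintype.card (μ → K) : ℂ) • reduceTo B (qqssEncoder p V G₂ X) =
      reduceTo B (qqssEncoder p V G₂ (((Fintype.card (Fin ℓ → K) : ℂ) * X.trace) • 1)) :=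
    fun X => by
      rw [← sum_conj_eq_trace_smul_one hU1 hU0 hcard X, qqssEncoder_eq_krausMap _ _ _ (∑ _, _),
        map_sum, reduceTo_sum]
      simp_rw [← qqssEncoder_eq_krausMap, hconst]
      rw [Finset.sum_const, Finset.card_univ, Nat.cast_smul_eq_nsmul]
  have h := havg ρ
  rw [hρ.2, ← hσ.2, ← havg σ] at h
  exact smul_right_injective _ (by simp : (Fintype.card (μ → K) : ℂ) ≠ 0) h

omit [Fintype ι] [DecidableEq ι] [Algebra (ZMod p) K] [Field K] in
theorem traceFst_mul_kronecker_one {B : Type*} [Fintype B] [DecidableEq B]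
    (P : Matrix (B × (Fin ℓ → K)) (B × (Fin ℓ → K)) ℂ) (ρ : Matrix B B ℂ) :
    traceFst (((ρ ⊗ₖ Matrix.vecMulVec (maxEntangled (K := K) (ℓ := ℓ)) (star maxEntangled)).submatrix
          (Equiv.prodAssoc B (Fin ℓ → K) (Fin ℓ → K))
          (Equiv.prodAssoc B (Fin ℓ → K) (Fin ℓ → K))) *
        (P ⊗ₖ (1 : Matrix (Fin ℓ → K) (Fin ℓ → K) ℂ))) = teleportResidue P ρ := by
  ext t t'
  simp only [traceFst, teleportResidue, trace_kronecker_single_mul, Matrix.of_apply,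
    Matrix.mul_apply, Matrix.submatrix_apply, Equiv.prodAssoc_apply, Matrix.kroneckerMap_apply,
    Matrix.vecMulVec_apply, maxEntangled, Pi.star_apply, Fintype.sum_prod_type, Matrix.one_apply,
    RCLike.star_def, apply_ite (starRingEnd ℂ), conj_inv_sqrt_card, map_zero, ite_mul, mul_ite,
    mul_one, mul_zero, zero_mul, Finset.sum_ite_eq', Finset.mem_univ, if_true,
    inv_sqrt_card_mul_self, Finset.mul_sum]
  refine Finset.sum_congr rfl fun b _ => ?_
  rw [Finset.sum_comm]
  refine Finset.sum_congr rfl fun b' _ => ?_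
  rw [Finset.sum_ite_eq', if_pos (Finset.mem_univ _)]
  ring

theorem teleportDecoder_eq {B : Type*} [Fintype B] [DecidableEq B]
    (P : (μ → K) → Matrix (B × (Fin ℓ → K)) (B × (Fin ℓ → K)) ℂ) :
    teleportDecoder p V F P = fun ρ => ∑ m, logicalWeyl p V (F *ᵥ m) *
      teleportResidue (P m) ρ * (logicalWeyl p V (F *ᵥ m))ᴴ := by
  ext1 ρ
  simp only [teleportDecoder, traceFst_mul_kronecker_one]

include hcard in
/-- Teleportation with a decoder of the EASS protocol is a decoder of the QQSS protocol. -/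
theorem IsStabilizerEncoding.qqssDecodes_teleportDecoder (hV : IsStabilizerEncoding p G₁ V)
    (hF : ColumnOrthogonal p F G₁) (hind : ∀ m, F *ᵥ m ∈ LinearMap.range G₁.mulVecLin → m = 0)
    {G₂ : Matrix (ι ⊕ ι) κ K} {A : Finset ι}
    {P : (μ → K) → Matrix ((A → K) × (Fin ℓ → K)) ((A → K) × (Fin ℓ → K)) ℂ}
    (hP : EASSDecodes (eassState p V G₂ F) A P) :
    QQSSDecodes (qqssEncoder p V G₂) A (teleportDecoder p V F P) := by
  have hU1 : ∀ m, (logicalWeyl p V (F *ᵥ m))ᴴ * logicalWeyl p V (F *ᵥ m) = 1 := fun m =>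
    hV.conjTranspose_logicalWeyl_mul_self (hF m)
  rw [teleportDecoder_eq]
  refine ⟨isTPCP_sum_conj_teleportResidue hU1 hP.1, fun ρ _ => ?_⟩
  rw [qqssEncoder_eq_krausMap, reduceTo_krausMap]
  refine sum_conj_teleportResidue_krausMap hU1
    (fun m m' h => hV.trace_conjTranspose_logicalWeyl_mul hF hind h) hcard
    (sum_reducedKraus A (sum_encoderKraus p hV.1 G₂)) hP.1 (fun m => ?_) ρ
  rw [← reduceToWith_sum_kronecker, ← hV.eassState_eq (hF m), hP.2]

end Security

/-! ### Acceptance and rejection in terms of `G₁`, `G₂` and `F` -/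

section Acceptance

variable {K : Type*} [Field K] {ι κ κ' μ : Type*} [Fintype κ] [Fintype κ'] [Fintype μ]

theorem accepts_disjSum_iff (G₁ : Matrix (ι ⊕ ι) κ' K) (G₂ : Matrix (ι ⊕ ι) κ K)
    (F : Matrix (ι ⊕ ι) μ K) (A : Finset ι) :
    Accepts (Matrix.fromCols G₁ G₂) F (A.disjSum A) ↔
      ∀ m y u, restr A (F *ᵥ m) = restr A (G₁ *ᵥ y + G₂ *ᵥ u) → m = 0 := by
  rw [accepts_iff]
  simp_rw [forall_mem_disjSum_iff]
  refine forall_congr' fun m => ⟨fun h y u hyu => h (Sum.elim y u) ?_, fun h u hu =>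
    h (u ∘ Sum.inl) (u ∘ Sum.inr) ?_⟩
  · rw [hyu, Matrix.fromCols_mulVec_sumElim]
  · rw [hu, Matrix.fromCols_mulVec]

theorem rejects_disjSum_iff (G₁ : Matrix (ι ⊕ ι) κ' K) (G₂ : Matrix (ι ⊕ ι) κ K)
    (F : Matrix (ι ⊕ ι) μ K) (B : Finset ι) :
    Rejects (Matrix.fromCols G₁ G₂) F (B.disjSum B) ↔
      ∀ m, ∃ y u, restr B (F *ᵥ m) = restr B (G₁ *ᵥ y + G₂ *ᵥ u) := by
  rw [rejects_iff]
  simp_rw [forall_mem_disjSum_iff]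
  refine forall_congr' fun m => ⟨fun ⟨u, hu⟩ => ⟨u ∘ Sum.inl, u ∘ Sum.inr, ?_⟩,
    fun ⟨y, u, hyu⟩ => ⟨Sum.elim y u, ?_⟩⟩
  · rw [hu, Matrix.fromCols_mulVec]
  · rw [hyu, Matrix.fromCols_mulVec_sumElim]

/-- Independence of the columns of `(G₁, F)` makes the column spaces of `G₁` and `F` disjoint. -/
theorem eq_zero_of_mulVec_mem_range {G₁ : Matrix (ι ⊕ ι) κ' K} {F : Matrix (ι ⊕ ι) μ K}
    (hind : LinearIndependent K (Matrix.fromCols G₁ F).col) {m : μ → K}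
    (hm : F *ᵥ m ∈ LinearMap.range G₁.mulVecLin) : m = 0 := by
  obtain ⟨y, hy⟩ := hm
  rw [Matrix.mulVecLin_apply] at hy
  have hinj := Matrix.mulVec_injective_iff.mpr hind
  have h : Matrix.fromCols G₁ F *ᵥ Sum.elim (-y) m = Matrix.fromCols G₁ F *ᵥ 0 := by
    rw [Matrix.fromCols_mulVec_sumElim, Matrix.mulVec_neg, hy, Matrix.mulVec_zero, neg_add_cancel]
  ext j
  exact congrFun (hinj h) (Sum.inr j)

end Acceptance

end QSS

end

/-! ### The equivalence and the teleportation decoder -/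

theorem theorem4 (p : ℕ) [Fact p.Prime] (K : Type*) [Field K] [Fintype K] [DecidableEq K]
    [Algebra (ZMod p) K] (n ℓ s : ℕ) (hℓ : ℓ ≤ n)
    (G₁ : Matrix (Fin n ⊕ Fin n) (Fin (n - ℓ)) K)
    (G₂ : Matrix (Fin n ⊕ Fin n) (Fin s) K)
    (F : Matrix (Fin n ⊕ Fin n) (Fin (2 * ℓ)) K)
    (hG₁ : QSS.SelfColumnOrthogonal p G₁)
    (hF : QSS.ColumnOrthogonal p F G₁)
    (hind : LinearIndependent K (Matrix.fromCols G₁ F).col)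
    (V : Matrix (Fin n → K) (Fin ℓ → K) ℂ) (hV : QSS.IsStabilizerEncoding p G₁ V)
    (𝔄 𝔅 : Set (Finset (Fin n))) (hacc : QSS.IsAccessStructure 𝔄 𝔅) :
    List.TFAE
      [QSS.QQSSSecure (QSS.qqssEncoder p V G₂) 𝔄 𝔅,
        QSS.CSSSecure (Matrix.fromCols G₁ G₂) F
          (QSS.symplectification 𝔄) (QSS.symplectification 𝔅),
        QSS.IsMMSP (Matrix.fromCols G₁ G₂) F
          (QSS.symplectification 𝔄) (QSS.symplectification 𝔅),
        QSS.EASSSecure (QSS.eassState p V G₂ F) 𝔄 𝔅] ∧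
    ∀ A ∈ 𝔄, ∀ P : (Fin (2 * ℓ) → K) →
        Matrix ((A → K) × (Fin ℓ → K)) ((A → K) × (Fin ℓ → K)) ℂ,
      QSS.EASSDecodes (QSS.eassState p V G₂ F) A P →
        QSS.QQSSDecodes (QSS.qqssEncoder p V G₂) A (QSS.teleportDecoder p V F P) := by
  have hind' : ∀ m, F *ᵥ m ∈ LinearMap.range G₁.mulVecLin → m = 0 := fun m hm =>
    QSS.eq_zero_of_mulVec_mem_range hind hm
  -- With `2ℓ` columns in `F` there are as many logical operators as the dimension of the operator
  -- space, so they form a basis.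
  have hcard : Fintype.card (Fin (2 * ℓ) → K) =
      Fintype.card ((Fin ℓ → K) × (Fin ℓ → K)) := by
    simp only [Fintype.card_fun, Fintype.card_fin, Fintype.card_prod, two_mul, pow_add]
  have hdec : ∀ A : Finset (Fin n), ∀ P,
      QSS.EASSDecodes (QSS.eassState p V G₂ F) A P →
        QSS.QQSSDecodes (QSS.qqssEncoder p V G₂) A (QSS.teleportDecoder p V F P) :=
    fun A P hP => hV.qqssDecodes_teleportDecoder hcard hF hind' hP
  refine ⟨?_, fun A _ P hP => hdec A P hP⟩
  have hMMSP : QSS.IsMMSP (Matrix.fromCols G₁ G₂) F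
      (QSS.symplectification 𝔄) (QSS.symplectification 𝔅) ↔
      (∀ A ∈ 𝔄, ∀ m y u, QSS.restr A (F *ᵥ m) = QSS.restr A (G₁ *ᵥ y + G₂ *ᵥ u) → m = 0) ∧
        ∀ B ∈ 𝔅, ∀ m, ∃ y u, QSS.restr B (F *ᵥ m) = QSS.restr B (G₁ *ᵥ y + G₂ *ᵥ u) := by
    simp only [QSS.IsMMSP, QSS.symplectification, Set.forall_mem_image, QSS.accepts_disjSum_iff,
      QSS.rejects_disjSum_iff]
  tfae_have 2 ↔ 3 := QSS.cssSecure_iff_isMMSP _ _ _ _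
  tfae_have 1 → 3 := fun ⟨hA, hB⟩ => hMMSP.mpr
    ⟨fun A h m y u hm => by
      obtain ⟨D, hD⟩ := hA A h
      exact hV.eq_zero_of_qqssDecodes hF hind' hD hm,
    fun B h => hV.exists_of_eassState_eq hF (hV.eassState_eq_of_qqss hF (hB B h))⟩
  tfae_have 3 → 4 := fun h => ⟨fun A hA => hV.exists_eassDecodes hF ((hMMSP.mp h).1 A hA),
    fun B hB => hV.eassState_eq_of_exists hF ((hMMSP.mp h).2 B hB)⟩
  tfae_have 4 → 1 := fun ⟨hA, hB⟩ =>
    ⟨fun A h => by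
      obtain ⟨P, hP⟩ := hA A h
      exact ⟨_, hdec A P hP⟩,
    fun B h ρ σ hρ hσ => hV.qqssEncoder_eq_of_exists hcard hF hind'
      (hV.exists_of_eassState_eq hF (hB B h)) hρ hσ⟩
  tfae_finish
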